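/- **Setting.** Fix a finite relational signature with relation symbols $R_1,\dots,R_m$ of arities $k_1,\dots,k_m$, and a finite structure $\mathcal B=(B,R_1^{\mathcal B},\dots,R_m^{\mathcal B})$ of this signature. An instance of $\mathrm{Max\text{-}CSP}(\mathcal B)$ is a finite structure $\mathcal A=(A,R_1^{\mathcal A},\dots,R_m^{\mathcal A})$ of the same signature, given by its domain $A=\{0,\dots,n-1\}$ and a list of its constraints (the tuples in its relations, each with its relation symbol); its size is $|\mathcal A|=|A|+|R_1^{\mathcal A}|+\dots+|R_m^{\mathcal A}|$. A solution is a map $h:A\to B$, and its value is the number of constraints preserved by $h$, that is, $\sum_{i}\bigl|\{t\in R_i^{\mathcal A} : h(t)\in R_i^{\mathcal B}\}\bigr|$. In $\mathrm{Max\text{-}Sur\text{-}CSP}(\mathcal B)$ only surjective maps $h:A\to B$ are solutions, and the instances are the structures $\mathcal A$ with $|A|\ge |B|$. For a real number $r$, a solution of value $\mathrm{Val}$ is $r$-approximate if $\mathrm{Val}\ge r\cdot \mathrm{Opt}$, where $\mathrm{Opt}$ is the maximal value of a solution of the same instance. A maximization problem is polynomial-time $r$-approximable if there is a deterministic algorithm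 (Turing machine) which, on every instance $\mathcal A$, computes an $r$-approximate solution in time polynomial in $|\mathcal A|$. **Theorem.** Let $r\in(0,1]$. If $\mathrm{Max\text{-}CSP}(\mathcal B)$ is polynomial-time $r$-approximable, then $\mathrm{Max\text{-}Sur\text{-}CSP}(\mathcal B)$ is polynomial-time $(r-\epsilon)$-approximable for every real $\epsilon>0$. -/

import Mathlib

/-- A finite relational signature: relation symbols `R_0, ..., R_{m-1}` with their arities. -/
structure RelSignature where
  m : ℕ
  arity : Fin m → ℕ

/-- A relational structure of signature `σ` with underlying domain `D`. -/
structure RelStructure (σ : RelSignature) (D : Type) where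
  rel : (i : Fin σ.m) → Set (Fin (σ.arity i) → D)

namespace RelStructure

/-- The size `|D| + |R_0| + ... + |R_{m-1}|` of a finite structure. -/
noncomputable def size {σ : RelSignature} {D : Type} (𝒜 : RelStructure σ D) : ℕ :=
  Nat.card D + ∑ i, (𝒜.rel i).ncard

/-- The number of constraints of `𝒜` (tuples in the relations of `𝒜`) that `h` maps into the
corresponding relation of `ℬ`. -/
noncomputable def preserved {σ : RelSignature} {A B : Type} (𝒜 : RelStructure σ A)
    (ℬ : RelStructure σ B) (h : A → B) : ℕ :=
  ∑ i, {t | t ∈ 𝒜.rel i ∧ h ∘ t ∈ ℬ.rel i}.ncard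

end RelStructure

/-- A finite `σ`-structure as it is given to an algorithm: the domain is `{0, ..., n-1}`, and the
pairs `(i, t)` with `t` in the `i`-th relation are listed in some order, without repetition. -/
structure CSPInput (σ : RelSignature) where
  n : ℕ
  constraints : List (Σ i : Fin σ.m, (Fin (σ.arity i) → Fin n))
  nodup : constraints.Nodup

namespace CSPInput

/-- The `σ`-structure presented by the list. -/
def toStructure {σ : RelSignature} (I : CSPInput σ) : RelStructure σ (Fin I.n) where
  rel i := {t | ⟨i, t⟩ ∈ I.constraints}

/-- The alphabet in which inputs are written. -/
inductive Sym (σ : RelSignature) : Type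
  | tick : Sym σ
  | endVar : Sym σ
  | relSym : Fin σ.m → Sym σ

/-- A constraint is written as its relation symbol followed by the entries of its tuple, the
variable `v` being written as `v` ticks and an end marker. -/
def encodeConstraint {σ : RelSignature} {n : ℕ}
    (c : Σ i : Fin σ.m, (Fin (σ.arity i) → Fin n)) : List (Sym σ) :=
  Sym.relSym c.1 ::
    (List.ofFn c.2).flatMap fun v : Fin n => List.replicate v.val Sym.tick ++ [Sym.endVar]

/-- The word presented to the machine: `n` ticks followed by the constraints. As `n` is at most the
size of the structure and the arities are fixed, its length is polynomially related to the size. -/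
def encode {σ : RelSignature} (I : CSPInput σ) : List (Sym σ) :=
  List.replicate I.n Sym.tick ++ I.constraints.flatMap encodeConstraint

end CSPInput

/-- A maximization problem: instances with their size, the solutions of every instance with their
value, and the words by which instances and solutions are represented. -/
structure MaxProblem where
  Inst : Type
  size : Inst → ℕ
  Sol : Inst → Type
  val : (I : Inst) → Sol I → ℕ
  InSym : Type
  OutSym : Type
  encodeInst : Inst → List InSym
  encodeSol : (I : Inst) → Sol I → List OutSym

namespace MaxProblem

/-- The solution `s` of `I` is `r`-approximate: its value is at least `r` times the maximal value of
a solution of `I`. -/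
def IsApproximate (P : MaxProblem) (r : ℝ) (I : P.Inst) (s : P.Sol I) : Prop :=
  ∃ opt : ℕ, IsGreatest (Set.range (P.val I)) opt ∧ r * (opt : ℝ) ≤ (P.val I s : ℝ)

/-- There is a polynomial-time `r`-approximation algorithm for `P`: a deterministic multi-stack
Turing machine which, on every instance `I`, outputs an `r`-approximate solution of `I` within a
number of steps that is polynomial in the size of `I`. -/
def PolyTimeApproximable (P : MaxProblem) (r : ℝ) : Prop :=
  ∃ (M : Turing.TM2ComputableAux P.InSym P.OutSym) (p : Polynomial ℕ),
    ∀ I : P.Inst, ∃ s : P.Sol I, P.IsApproximate r I s ∧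
      Nonempty (Turing.TM2OutputsInTime M.tm
        ((P.encodeInst I).map M.inputAlphabet.symm)
        (some ((P.encodeSol I s).map M.outputAlphabet.symm))
        (p.eval (P.size I)))

end MaxProblem

/-- `Max-CSP(ℬ)`: the solutions of `𝒜` are all maps from `A` to `B`, the value is the number of
preserved constraints, and a map is written as the list of its values. -/
noncomputable def maxCSP {σ : RelSignature} {B : Type} (ℬ : RelStructure σ B) : MaxProblem where
  Inst := CSPInput σ
  size I := I.toStructure.size
  Sol I := Fin I.n → B
  val I h := I.toStructure.preserved ℬ h
  InSym := CSPInput.Sym σ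
  OutSym := B
  encodeInst I := I.encode
  encodeSol _ h := List.ofFn h

/-- `Max-Sur-CSP(ℬ)`: as `Max-CSP(ℬ)`, with only the surjective maps as solutions and only the
structures with `|A| ≥ |B|` as instances. -/
noncomputable def maxSurCSP {σ : RelSignature} {B : Type} (ℬ : RelStructure σ B) : MaxProblem where
  Inst := {I : CSPInput σ // Nat.card B ≤ I.n}
  size I := I.1.toStructure.size
  Sol I := {h : Fin I.1.n → B // Function.Surjective h}
  val I h := I.1.toStructure.preserved ℬ h.1
  InSym := CSPInput.Sym σ
  OutSym := B
  encodeInst I := I.1.encode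
  encodeSol _ h := List.ofFn h.1

/-!
A polynomial-time `r`-approximation for `Max-CSP(ℬ)` is turned into one for `Max-Sur-CSP(ℬ)` as
follows. Let `b = |B|`, and let `h` be the solution that the given machine `M` finds for a structure
with `n ≥ b` elements. For each window `[j, j + b)` of `b` consecutive elements of
`{0, ..., n - 1}`, override `h` on the window by a list of all elements of `B`; this makes it
surjective. A constraint satisfied by `h` can be lost only if one of its entries lies in the window,
and each entry lies in at most `b` windows. If `N` bounds the arities, then all `n - b + 1` windows
together lose at most `N * b * Val(h)` (`sum_valueOf_window`), so the best of them has value at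
least `(1 - ε) * Val(h)` as soon as `N * b ≤ ε * (n - b + 1)` (`approx_of_average`). As
`Val(h) ≥ r * Opt`, and the optimum over all maps is at least that over the surjective ones, the
best override is an `(r - ε)`-approximation. There are finitely many structures with fewer elements,
since the constraints are listed without repetition; for them optimal solutions are kept in a table
(`exists_table`, `CSPInput.exists_length_encode_lt`).

The algorithm is implemented as a multi-stack machine (`SurAlg.machine`) on the stacks of `M` and
nine work stacks. Code is assembled from fragments (`Frag`) by sequencing, case distinction and
loops, and `Frag.Runs` bounds the number of steps of a fragment together with its effect. The stack
`p` holds the override as a list of optional values, which is `j` times `none` followed by the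
elements of `B`: popping it moves the window by one place to the left, and positions beyond its end
are not overridden. To find the best window, the value of each override is tallied on the stack `dR`
while the best value so far is popped from `d`, so that `d` runs empty precisely if the new value is
at least as large. The stack `e` counts the rounds since the best one; when the windows are
exhausted, its height is the position of the best window (`runs_search`).
-/

open Turing TM2

/-! ### Fragments of multi-stack machines -/

/-- A code fragment of a multi-stack machine; reaching `halt` means leaving the fragment. -/
structure Frag {K : Type} (Γ : K → Type) (σ : Type) where
  /-- the labels -/
  Λ : Type
  /-- the labels are finite in number -/
  fin : Fintype Λ
  /-- the entry -/
  main : Λ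
  /-- the statement at each label -/
  m : Λ → Stmt Γ Λ σ

/-- `StepsTo f n a b`: exactly `n` steps of the transition function `f` lead from `a` to `b`. -/
inductive StepsTo {α : Type} (f : α → Option α) : ℕ → α → α → Prop
  | refl (a : α) : StepsTo f 0 a a
  | head {n : ℕ} {a b c : α} : f a = some b → StepsTo f n b c → StepsTo f (n + 1) a c

namespace StepsTo

theorem trans {α : Type} {f : α → Option α} {m n : ℕ} {a b c : α} (h₁ : StepsTo f m a b)
    (h₂ : StepsTo f n b c) : StepsTo f (m + n) a c := by
  induction h₁ with
  | refl a => simpa using h₂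
  | @head k a b _ h _ ih =>
    have : k + 1 + n = k + n + 1 := by omega
    rw [this]
    exact .head h (ih h₂)

theorem iterate_bind_none {α : Type} (f : α → Option α) (n : ℕ) :
    (flip bind f)^[n] none = none :=
  Function.iterate_fixed rfl n

theorem iff_iterate {α : Type} {f : α → Option α} {n : ℕ} {a b : α} :
    StepsTo f n a b ↔ (flip bind f)^[n] (some a) = some b := by
  induction n generalizing a with
  | zero =>
    constructor
    · rintro ⟨⟩; rfl
    · intro h
      obtain rfl : a = b := by simpa using h
      exact .refl a
  | succ n ih =>
    have key : (flip bind f)^[n + 1] (some a) = (flip bind f)^[n] (f a) := rfl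
    rw [key]
    constructor
    · rintro (_ | ⟨h, h'⟩)
      rw [h]
      exact ih.1 h'
    · intro h
      cases hfa : f a with
      | none => rw [hfa, iterate_bind_none] at h; cases h
      | some c =>
        rw [hfa] at h
        exact .head hfa (ih.2 h)

end StepsTo

section Fragments

variable {K : Type} {Γ : K → Type} {σ : Type}

/-- Relabel a statement along `f` and replace its `halt`s by the statement `e`. -/
def Turing.TM2.Stmt.graft {Λ Λ' : Type} (q : Stmt Γ Λ σ) (f : Λ → Λ') (e : Stmt Γ Λ' σ) :
    Stmt Γ Λ' σ :=
  match q with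
  | .push k g q => .push k g (q.graft f e)
  | .peek k g q => .peek k g (q.graft f e)
  | .pop k g q => .pop k g (q.graft f e)
  | .load g q => .load g (q.graft f e)
  | .branch c q₁ q₂ => .branch c (q₁.graft f e) (q₂.graft f e)
  | .goto l => .goto fun v => f (l v)
  | .halt => e

/-- A sequence of pushes, in the order that leaves the list on top of the stack. -/
def Turing.TM2.Stmt.pushList {Λ : Type} (k : K) (l : List (Γ k)) (q : Stmt Γ Λ σ) : Stmt Γ Λ σ :=
  l.foldl (fun q x => .push k (fun _ => x) q) q

/-- A sequence of `n` pops whose results are ignored. -/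
def Turing.TM2.Stmt.popMany {Λ : Type} (k : K) (n : ℕ) (q : Stmt Γ Λ σ) : Stmt Γ Λ σ :=
  (Stmt.pop k fun v _ => v)^[n] q

variable [DecidableEq K]

theorem stepAux_graft_goto {Λ Λ' : Type} (f : Λ → Λ') (e : Stmt Γ Λ' σ) (q : Stmt Γ Λ σ)
    {v v' : σ} {S S' : ∀ k, List (Γ k)} {l : Λ} (h : stepAux q v S = ⟨some l, v', S'⟩) :
    stepAux (q.graft f e) v S = ⟨some (f l), v', S'⟩ := by
  induction q generalizing v S with
  | branch c q₁ q₂ ih₁ ih₂ =>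
    simp only [stepAux, Stmt.graft] at h ⊢
    cases hc : c v <;> simp only [hc, cond_true, cond_false] at h ⊢
    exacts [ih₂ h, ih₁ h]
  | goto g =>
    simp only [stepAux, Stmt.graft, Cfg.mk.injEq, Option.some.injEq] at h ⊢
    obtain ⟨rfl, rfl, rfl⟩ := h
    simp
  | halt => simp [stepAux] at h
  | _ =>
    rename_i ih
    exact ih h

theorem stepAux_graft_halt {Λ Λ' : Type} (f : Λ → Λ') (e : Stmt Γ Λ' σ) (q : Stmt Γ Λ σ)
    {v v' : σ} {S S' : ∀ k, List (Γ k)} (h : stepAux q v S = ⟨none, v', S'⟩) :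
    stepAux (q.graft f e) v S = stepAux e v' S' := by
  induction q generalizing v S with
  | branch c q₁ q₂ ih₁ ih₂ =>
    simp only [stepAux, Stmt.graft] at h ⊢
    cases hc : c v <;> simp only [hc, cond_true, cond_false] at h ⊢
    exacts [ih₂ h, ih₁ h]
  | goto g => simp [stepAux] at h
  | halt =>
    simp only [stepAux, Stmt.graft, Cfg.mk.injEq] at h ⊢
    obtain ⟨-, rfl, rfl⟩ := h
    rfl
  | _ =>
    rename_i ih
    exact ih h

theorem stepAux_pushList {Λ : Type} (k : K) (l : List (Γ k)) (q : Stmt Γ Λ σ) (v : σ)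
    (S : ∀ k, List (Γ k)) :
    stepAux (q.pushList k l) v S = stepAux q v (Function.update S k (l ++ S k)) := by
  induction l generalizing q S with
  | nil => simp [Stmt.pushList]
  | cons x l ih =>
    simp only [Stmt.pushList, List.foldl_cons] at ih ⊢
    rw [ih]
    simp [stepAux]

theorem stepAux_popMany {Λ : Type} (k : K) (n : ℕ) (q : Stmt Γ Λ σ) (v : σ)
    (S : ∀ k, List (Γ k)) :
    stepAux (q.popMany k n) v S = stepAux q v (Function.update S k ((S k).drop n)) := by
  induction n generalizing S with
  | zero => simp [Stmt.popMany]
  | succ n ih =>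
    simp only [Stmt.popMany, Function.iterate_succ_apply'] at ih ⊢
    simp only [stepAux]
    rw [ih]
    simp [List.drop_tail]

/-- A halting run of a program is simulated by any program in which it is grafted. -/
theorem StepsTo.graft {Λ Λ' : Type} {m : Λ → Stmt Γ Λ σ} {m' : Λ' → Stmt Γ Λ' σ} {f : Λ → Λ'}
    {e : Stmt Γ Λ' σ} (hm : ∀ l, m' (f l) = (m l).graft f e) {n : ℕ} {l : Λ} {v v' : σ}
    {S S' : ∀ k, List (Γ k)} (h : StepsTo (step m) n ⟨some l, v, S⟩ ⟨none, v', S'⟩) :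
    StepsTo (step m') n ⟨some (f l), v, S⟩ (stepAux e v' S') := by
  generalize ha : (⟨some l, v, S⟩ : Cfg Γ Λ σ) = a at h
  generalize hb : (⟨none, v', S'⟩ : Cfg Γ Λ σ) = b at h
  induction h generalizing l v S with
  | refl a => subst ha; simp at hb
  | @head n a b c hab hbc ih =>
    subst ha hb
    simp only [step, Option.some.injEq] at hab
    obtain ⟨_ | l₁, v₁, S₁⟩ := b
    · cases hbc with
      | refl =>
        refine .head ?_ (.refl _)
        simp only [step, hm]
        rw [stepAux_graft_halt f e _ hab]
      | head h _ => simp [step] at h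
    · refine .head ?_ (ih rfl rfl)
      simp only [step, hm]
      rw [stepAux_graft_goto f e _ hab]

namespace Frag

/-- `F.Runs v S v' S' n`: started with internal state `v` and stacks `S`, the fragment `F` is left
after at most `n` steps with internal state `v'` and stacks `S'`. -/
def Runs (F : Frag Γ σ) (v : σ) (S : ∀ k, List (Γ k)) (v' : σ) (S' : ∀ k, List (Γ k)) (n : ℕ) :
    Prop :=
  ∃ m ≤ n, StepsTo (step F.m) m ⟨some F.main, v, S⟩ ⟨none, v', S'⟩

theorem Runs.mono {F : Frag Γ σ} {v v' : σ} {S S' : ∀ k, List (Γ k)} {n n' : ℕ}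
    (h : F.Runs v S v' S' n) (hn : n ≤ n') : F.Runs v S v' S' n' :=
  let ⟨m, hm, hs⟩ := h
  ⟨m, hm.trans hn, hs⟩

theorem Runs.congr {F : Frag Γ σ} {v v' : σ} {S S' S'' : ∀ k, List (Γ k)} {n n' : ℕ}
    (h : F.Runs v S v' S' n) (hS : S' = S'') (hn : n ≤ n') : F.Runs v S v' S'' n' :=
  hS ▸ h.mono hn

/-- Run `F`, then `G`. -/
def seq (F G : Frag Γ σ) : Frag Γ σ where
  Λ := F.Λ ⊕ G.Λ
  fin := letI := F.fin; letI := G.fin; inferInstance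
  main := .inl F.main
  m
    | .inl l => (F.m l).graft .inl (.goto fun _ => .inr G.main)
    | .inr l => (G.m l).graft .inr .halt

theorem Runs.seq {F G : Frag Γ σ} {v v₁ v₂ : σ} {S S₁ S₂ : ∀ k, List (Γ k)} {n₁ n₂ : ℕ}
    (hF : F.Runs v S v₁ S₁ n₁) (hG : G.Runs v₁ S₁ v₂ S₂ n₂) :
    (F.seq G).Runs v S v₂ S₂ (n₁ + n₂) := by
  obtain ⟨m₁, hm₁, h₁⟩ := hF
  obtain ⟨m₂, hm₂, h₂⟩ := hG
  refine ⟨m₁ + m₂, by omega, ?_⟩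
  exact (h₁.graft (m' := (F.seq G).m) (f := .inl) fun _ => rfl).trans
    (h₂.graft (m' := (F.seq G).m) (f := .inr) (e := .halt) fun _ => rfl)

/-- Execute the statement `hd`, which is left either by `halt` or by a jump to an index `i`; in the
latter case, run `F i`. -/
def cases {ι : Type} [Fintype ι] (hd : Stmt Γ ι σ) (F : ι → Frag Γ σ) : Frag Γ σ where
  Λ := Option (Σ i, (F i).Λ)
  fin := letI := fun i => (F i).fin; inferInstance
  main := none
  m
    | none => hd.graft (fun i => some ⟨i, (F i).main⟩) .halt
    | some ⟨i, l⟩ => ((F i).m l).graft (fun l => some ⟨i, l⟩) .halt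

/-- As `cases`, but return to `hd` whenever one of the `F i` is left. -/
def loop {ι : Type} [Fintype ι] (hd : Stmt Γ ι σ) (F : ι → Frag Γ σ) : Frag Γ σ where
  Λ := Option (Σ i, (F i).Λ)
  fin := letI := fun i => (F i).fin; inferInstance
  main := none
  m
    | none => hd.graft (fun i => some ⟨i, (F i).main⟩) .halt
    | some ⟨i, l⟩ => ((F i).m l).graft (fun l => some ⟨i, l⟩) (.goto fun _ => none)

/-- A single statement without jumps. -/
def atom (q : Stmt Γ Empty σ) : Frag Γ σ := cases q Empty.elim

section

variable {ι : Type} [Fintype ι] {hd : Stmt Γ ι σ} {F : ι → Frag Γ σ} {v v₁ v₂ v₃ : σ}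
  {S S₁ S₂ S₃ : ∀ k, List (Γ k)} {n₁ n₂ : ℕ} {i : ι}

theorem Runs.cases_halt (h : stepAux hd v S = ⟨none, v₁, S₁⟩) :
    (cases hd F).Runs v S v₁ S₁ 1 := by
  refine ⟨1, le_rfl, .head (congrArg some ?_) (.refl _)⟩
  exact stepAux_graft_halt _ _ _ h

theorem Runs.cases_goto (h : stepAux hd v S = ⟨some i, v₁, S₁⟩)
    (hF : (F i).Runs v₁ S₁ v₂ S₂ n₁) : (cases hd F).Runs v S v₂ S₂ (n₁ + 1) := by
  obtain ⟨m₁, hm₁, h₁⟩ := hF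
  refine ⟨m₁ + 1, by omega, .head (congrArg some ?_)
    (h₁.graft (m' := (cases hd F).m) (f := fun l => some ⟨i, l⟩) (e := .halt) fun _ => rfl)⟩
  exact stepAux_graft_goto _ _ _ h

theorem Runs.loop_halt (h : stepAux hd v S = ⟨none, v₁, S₁⟩) :
    (loop hd F).Runs v S v₁ S₁ 1 := by
  refine ⟨1, le_rfl, .head (congrArg some ?_) (.refl _)⟩
  exact stepAux_graft_halt _ _ _ h

theorem Runs.loop_goto (h : stepAux hd v S = ⟨some i, v₁, S₁⟩)
    (hF : (F i).Runs v₁ S₁ v₂ S₂ n₁) (hL : (loop hd F).Runs v₂ S₂ v₃ S₃ n₂) :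
    (loop hd F).Runs v S v₃ S₃ (n₂ + n₁ + 1) := by
  obtain ⟨m₁, hm₁, h₁⟩ := hF
  obtain ⟨m₂, hm₂, h₂⟩ := hL
  refine ⟨m₁ + m₂ + 1, by omega, .head (congrArg some ?_)
    ((h₁.graft (m' := (loop hd F).m) (f := fun l => some ⟨i, l⟩) fun _ => rfl).trans h₂)⟩
  exact stepAux_graft_goto _ _ _ h

theorem Runs.atom {q : Stmt Γ Empty σ} (h : stepAux q v S = ⟨none, v₁, S₁⟩) :
    (atom q).Runs v S v₁ S₁ 1 :=
  .cases_halt h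

/-- A loop whose body is empty. -/
def iter (q : Stmt Γ Unit σ) : Frag Γ σ := loop q fun _ => atom .halt

theorem Runs.iter_halt {q : Stmt Γ Unit σ} (h : stepAux q v S = ⟨none, v₁, S₁⟩) :
    (iter q).Runs v S v₁ S₁ 1 :=
  .loop_halt h

theorem Runs.iter_goto {q : Stmt Γ Unit σ} (h : stepAux q v S = ⟨some (), v₁, S₁⟩)
    (hL : (iter q).Runs v₁ S₁ v₂ S₂ n₁) : (iter q).Runs v S v₂ S₂ (n₁ + 2) :=
  (Runs.loop_goto h (.atom rfl) hL).mono (by omega)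

end

section

variable {v : σ} {S : ∀ k, List (Γ k)} {a b : K} {set : σ → Option (Γ a) → σ} {full : σ → Bool}
  {get : σ → Γ b} {conv : Γ a → Γ b}

/-- Pop the stack `a` until it is empty. Popped symbols are stored by `set`, and `full` tells
whether there was one. -/
def clear (a : K) (set : σ → Option (Γ a) → σ) (full : σ → Bool) : Frag Γ σ :=
  iter (.pop a set (.branch full (.goto fun _ => ()) .halt))

/-- Pop the stack `a` until it is empty, and push each symbol, as translated by `get`, onto `b`. -/
def move (a b : K) (set : σ → Option (Γ a) → σ) (full : σ → Bool) (get : σ → Γ b) : Frag Γ σ :=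
  iter (.pop a set (.branch full (.push b get (.goto fun _ => ())) .halt))

theorem Runs.clear (hset : ∀ v x y, set (set v x) y = set v y)
    (hfull : ∀ v x, full (set v x) = x.isSome) :
    (clear a set full).Runs v S (set v none) (Function.update S a []) (2 * (S a).length + 1) := by
  generalize hl : S a = l
  induction l generalizing S v with
  | nil => exact .iter_halt (by simp [stepAux, hfull, hl])
  | cons x l ih =>
    have h := ih (v := set v (some x)) (S := Function.update S a l) (by simp)
    rw [hset, Function.update_idem] at h
    exact .iter_goto (by simp [stepAux, hfull, hl]) h

theorem Runs.move (hab : a ≠ b) (hset : ∀ v x y, set (set v x) y = set v y)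
    (hfull : ∀ v x, full (set v x) = x.isSome) (hget : ∀ v x, get (set v (some x)) = conv x) :
    (move a b set full get).Runs v S (set v none)
      (Function.update (Function.update S a []) b ((S a).reverse.map conv ++ S b))
      (2 * (S a).length + 1) := by
  generalize hl : S a = l
  induction l generalizing S v with
  | nil => exact .iter_halt (by simp [stepAux, hfull, hl, hab.symm])
  | cons x l ih =>
    have h := ih (v := set v (some x))
      (S := Function.update (Function.update S a l) b (conv x :: S b)) (by simp [hab])
    refine .iter_goto (v₁ := set v (some x))
      (S₁ := Function.update (Function.update S a l) b (conv x :: S b)) ?_ ?_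
    · simp [stepAux, hfull, hl, hget, hab.symm]
    · rw [hset] at h
      refine (congrArg₂ (fun S' n => (Frag.move a b set full get).Runs _ _ _ S' n) ?_ rfl).mp h
      funext k
      by_cases hb : k = b
      · subst hb; simp
      · by_cases ha : k = a
        · subst ha; simp [hb]
        · simp [ha, hb]

end

end Frag

end Fragments

/-! ### Stacks and registers of the algorithm -/

/-- Lists of length at most `N`. -/
abbrev BoundedList (A : Type) (N : ℕ) : Type := {l : List A // l.length ≤ N}

namespace BoundedList

noncomputable instance {A : Type} [Finite A] {N : ℕ} : Fintype (BoundedList A N) :=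
  (List.finite_length_le A N).fintype

/-- The empty list. -/
def nil {A : Type} {N : ℕ} : BoundedList A N := ⟨[], Nat.zero_le N⟩

/-- Append a letter, unless the list is full. -/
def snoc {A : Type} {N : ℕ} (l : BoundedList A N) (x : A) : BoundedList A N :=
  ⟨(l.1 ++ [x]).take N, List.length_take_le N _⟩

end BoundedList

/-- The work stacks of the algorithm. Each of the stacks `w` (the word of constraints), `h` (the
assignment), `p` (the overriding values) and `d` (a tally of the best value) comes with a stack on
which it is reversed while it is read; `e` is a tally of the rounds since the best one. -/
inductive WorkStack : Type
  | w | wR | h | hR | p | pR | d | dR | e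
  deriving DecidableEq

instance : Fintype WorkStack :=
  ⟨{.w, .wR, .h, .hR, .p, .pR, .d, .dR, .e}, by rintro (_ | _) <;> decide⟩

/-- The alphabets of the work stacks. -/
@[reducible] def WorkStack.Γ (σ : RelSignature) (B : Type) : WorkStack → Type
  | .w | .wR => CSPInput.Sym σ
  | .h | .hR => B
  | .p | .pR | .d | .dR | .e => Option B

/-- The contents of the work stacks. -/
structure Work (σ : RelSignature) (B : Type) where
  (w wR : List (CSPInput.Sym σ))
  (h hR : List B)
  (p pR d dR e : List (Option B))

/-- The contents of the work stacks as a family. -/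
def Work.stk {σ : RelSignature} {B : Type} (r : Work σ B) :
    (k : WorkStack) → List (WorkStack.Γ σ B k)
  | .w => r.w
  | .wR => r.wR
  | .h => r.h
  | .hR => r.hR
  | .p => r.p
  | .pR => r.pR
  | .d => r.d
  | .dR => r.dR
  | .e => r.e

/-- The finite memory of the algorithm: registers `rs`, `rb`, `rp` for the last symbol read in each
alphabet, the constraint being evaluated (its symbol `sym` and the values `vals` of its variables so
far), and a prefix `buf` of the input. -/
structure Reg (σ : RelSignature) (B : Type) (N L : ℕ) where
  rs : Option (CSPInput.Sym σ)
  rb : Option B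
  rp : Option (Option B)
  sym : Option (Fin σ.m)
  vals : BoundedList B N
  buf : BoundedList (CSPInput.Sym σ) L

noncomputable instance {σ : RelSignature} : Fintype (CSPInput.Sym σ) :=
  .ofInjective
    (fun s : CSPInput.Sym σ => (match s with
      | .tick => .inl true
      | .endVar => .inl false
      | .relSym i => .inr i : Bool ⊕ Fin σ.m))
    (by rintro (_ | _ | _) (_ | _ | _) h <;> simp_all)

instance {σ : RelSignature} {B : Type} [Finite B] {N L : ℕ} : Finite (Reg σ B N L) :=
  Finite.of_injective (fun r : Reg σ B N L => (r.rs, r.rb, r.rp, r.sym, r.vals, r.buf))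
    (by rintro ⟨⟩ ⟨⟩ h; simp_all)

namespace SurAlg

variable {σ : RelSignature} {B : Type} (M : TM2ComputableAux (CSPInput.Sym σ) B) {N L : ℕ}

/-- The alphabets of the combined machine: the stacks of `M` and the work stacks. -/
@[reducible] def Γ : M.tm.K ⊕ WorkStack → Type
  | .inl k => M.tm.Γ k
  | .inr k => WorkStack.Γ σ B k

variable {M}

/-- The stacks of the combined machine. -/
def stk (T : ∀ k, List (M.tm.Γ k)) (r : Work σ B) : ∀ k, List (Γ M k)
  | .inl k => T k
  | .inr k => r.stk k

section

variable (T : ∀ k, List (M.tm.Γ k)) (r : Work σ B)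

@[simp] theorem stk_inl (k : M.tm.K) : stk T r (.inl k) = T k := rfl
@[simp] theorem stk_w : stk T r (.inr .w) = r.w := rfl
@[simp] theorem stk_wR : stk T r (.inr .wR) = r.wR := rfl
@[simp] theorem stk_h : stk T r (.inr .h) = r.h := rfl
@[simp] theorem stk_hR : stk T r (.inr .hR) = r.hR := rfl
@[simp] theorem stk_p : stk T r (.inr .p) = r.p := rfl
@[simp] theorem stk_pR : stk T r (.inr .pR) = r.pR := rfl
@[simp] theorem stk_d : stk T r (.inr .d) = r.d := rfl
@[simp] theorem stk_dR : stk T r (.inr .dR) = r.dR := rfl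
@[simp] theorem stk_e : stk T r (.inr .e) = r.e := rfl

@[simp] theorem update_inl (k : M.tm.K) (x : List (M.tm.Γ k)) :
    Function.update (stk T r) (.inl k) x = stk (Function.update T k x) r := by
  funext k'
  rcases k' with k' | k'
  · by_cases h : k' = k
    · subst h; simp [stk]
    · rw [Function.update_of_ne (by simpa using h)]
      simp [stk, Function.update_of_ne h]
  · rfl

@[simp] theorem update_w (x : List (CSPInput.Sym σ)) :
    Function.update (stk T r) (.inr .w) x = stk T { r with w := x } := by
  funext k; rcases k with _ | _ | _ <;> rfl
@[simp] theorem update_wR (x : List (CSPInput.Sym σ)) :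
    Function.update (stk T r) (.inr .wR) x = stk T { r with wR := x } := by
  funext k; rcases k with _ | _ | _ <;> rfl
@[simp] theorem update_h (x : List B) :
    Function.update (stk T r) (.inr .h) x = stk T { r with h := x } := by
  funext k; rcases k with _ | _ | _ <;> rfl
@[simp] theorem update_hR (x : List B) :
    Function.update (stk T r) (.inr .hR) x = stk T { r with hR := x } := by
  funext k; rcases k with _ | _ | _ <;> rfl
@[simp] theorem update_p (x : List (Option B)) :
    Function.update (stk T r) (.inr .p) x = stk T { r with p := x } := by
  funext k; rcases k with _ | _ | _ <;> rfl
@[simp] theorem update_pR (x : List (Option B)) :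
    Function.update (stk T r) (.inr .pR) x = stk T { r with pR := x } := by
  funext k; rcases k with _ | _ | _ <;> rfl
@[simp] theorem update_d (x : List (Option B)) :
    Function.update (stk T r) (.inr .d) x = stk T { r with d := x } := by
  funext k; rcases k with _ | _ | _ <;> rfl
@[simp] theorem update_dR (x : List (Option B)) :
    Function.update (stk T r) (.inr .dR) x = stk T { r with dR := x } := by
  funext k; rcases k with _ | _ | _ <;> rfl
@[simp] theorem update_e (x : List (Option B)) :
    Function.update (stk T r) (.inr .e) x = stk T { r with e := x } := by
  funext k; rcases k with _ | _ | _ <;> rfl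

end

/-- The internal states of the combined machine: those of `M`, and the finite memory. -/
abbrev St (M : TM2ComputableAux (CSPInput.Sym σ) B) (N L : ℕ) : Type := M.tm.σ × Reg σ B N L

/-- The state with empty alphabet registers. -/
def reg (q : M.tm.σ) (sym : Option (Fin σ.m)) (vals : BoundedList B N)
    (buf : BoundedList (CSPInput.Sym σ) L) : St M N L := (q, ⟨none, none, none, sym, vals, buf⟩)

/-- Empty the alphabet registers. -/
def clr (v : St M N L) : St M N L := reg v.1 v.2.sym v.2.vals v.2.buf

/-- Store a symbol of the input alphabet. -/
def setS (v : St M N L) (x : Option (CSPInput.Sym σ)) : St M N L := (v.1, { v.2 with rs := x })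
/-- Store an element of `B`. -/
def setB (v : St M N L) (x : Option B) : St M N L := (v.1, { v.2 with rb := x })
/-- Store an optional element of `B`. -/
def setP (v : St M N L) (x : Option (Option B)) : St M N L := (v.1, { v.2 with rp := x })


/-- Reverse `wR` onto `w`. -/
def moveW : Frag (Γ M) (St M N L) :=
  .move (.inr .wR) (.inr .w) setS (fun v => v.2.rs.isSome) fun v => v.2.rs.getD .tick

/-- Reverse `hR` onto `h`. -/
def moveH (b₀ : B) : Frag (Γ M) (St M N L) :=
  .move (.inr .hR) (.inr .h) setB (fun v => v.2.rb.isSome) fun v => v.2.rb.getD b₀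

/-- Reverse `pR` onto `p`. -/
def moveP : Frag (Γ M) (St M N L) :=
  .move (.inr .pR) (.inr .p) setP (fun v => v.2.rp.isSome) fun v => v.2.rp.getD none

/-- Reverse `dR` onto `d`. -/
def moveD : Frag (Γ M) (St M N L) :=
  .move (.inr .dR) (.inr .d) setP (fun v => v.2.rp.isSome) fun v => v.2.rp.getD none

/-- Move the tally `e` onto `p`. -/
def moveE : Frag (Γ M) (St M N L) :=
  .move (.inr .e) (.inr .p) setP (fun v => v.2.rp.isSome) fun v => v.2.rp.getD none

/-- Reverse the output of `M` onto `hR`. -/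
def moveOut (b₀ : B) : Frag (Γ M) (St M N L) :=
  .move (.inl M.tm.k₁) (.inr .hR) (fun v x => setB v (x.map M.outputAlphabet))
    (fun v => v.2.rb.isSome) fun v => v.2.rb.getD b₀

section

variable {q : M.tm.σ} {sym : Option (Fin σ.m)} {vals : BoundedList B N}
  {buf : BoundedList (CSPInput.Sym σ) L} {T : ∀ k, List (M.tm.Γ k)} {r : Work σ B} {b₀ : B}

theorem runs_moveW : moveW.Runs (reg q sym vals buf) (stk T r) (reg q sym vals buf)
    (stk T { r with w := r.wR.reverse ++ r.w, wR := [] }) (2 * r.wR.length + 1) := by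
  have := Frag.Runs.move (Γ := Γ M) (a := .inr .wR) (b := .inr .w) (v := reg q sym vals buf)
    (S := stk T r) (set := setS) (full := fun v => v.2.rs.isSome)
    (get := fun v => v.2.rs.getD .tick) (conv := id)
    (by simp) (fun _ _ _ => rfl) (fun _ _ => rfl) (fun _ _ => rfl)
  simp at this
  exact this

theorem runs_moveH : (moveH b₀).Runs (reg q sym vals buf) (stk T r) (reg q sym vals buf)
    (stk T { r with h := r.hR.reverse ++ r.h, hR := [] }) (2 * r.hR.length + 1) := by
  have := Frag.Runs.move (Γ := Γ M) (a := .inr .hR) (b := .inr .h) (v := reg q sym vals buf)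
    (S := stk T r) (set := setB) (full := fun v => v.2.rb.isSome)
    (get := fun v => v.2.rb.getD b₀) (conv := id)
    (by simp) (fun _ _ _ => rfl) (fun _ _ => rfl) (fun _ _ => rfl)
  simp at this
  exact this

theorem runs_moveP : moveP.Runs (reg q sym vals buf) (stk T r) (reg q sym vals buf)
    (stk T { r with p := r.pR.reverse ++ r.p, pR := [] }) (2 * r.pR.length + 1) := by
  have := Frag.Runs.move (Γ := Γ M) (a := .inr .pR) (b := .inr .p) (v := reg q sym vals buf)
    (S := stk T r) (set := setP) (full := fun v => v.2.rp.isSome)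
    (get := fun v => v.2.rp.getD none) (conv := id)
    (by simp) (fun _ _ _ => rfl) (fun _ _ => rfl) (fun _ _ => rfl)
  simp at this
  exact this

theorem runs_moveD : moveD.Runs (reg q sym vals buf) (stk T r) (reg q sym vals buf)
    (stk T { r with d := r.dR.reverse ++ r.d, dR := [] }) (2 * r.dR.length + 1) := by
  have := Frag.Runs.move (Γ := Γ M) (a := .inr .dR) (b := .inr .d) (v := reg q sym vals buf)
    (S := stk T r) (set := setP) (full := fun v => v.2.rp.isSome)
    (get := fun v => v.2.rp.getD none) (conv := id)
    (by simp) (fun _ _ _ => rfl) (fun _ _ => rfl) (fun _ _ => rfl)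
  simp at this
  exact this

theorem runs_moveE : moveE.Runs (reg q sym vals buf) (stk T r) (reg q sym vals buf)
    (stk T { r with p := r.e.reverse ++ r.p, e := [] }) (2 * r.e.length + 1) := by
  have := Frag.Runs.move (Γ := Γ M) (a := .inr .e) (b := .inr .p) (v := reg q sym vals buf)
    (S := stk T r) (set := setP) (full := fun v => v.2.rp.isSome)
    (get := fun v => v.2.rp.getD none) (conv := id)
    (by simp) (fun _ _ _ => rfl) (fun _ _ => rfl) (fun _ _ => rfl)
  simp at this
  exact this

theorem runs_moveOut : (moveOut b₀).Runs (reg q sym vals buf) (stk T r) (reg q sym vals buf)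
    (stk (Function.update T M.tm.k₁ [])
      { r with hR := (T M.tm.k₁).reverse.map M.outputAlphabet ++ r.hR })
    (2 * (T M.tm.k₁).length + 1) := by
  have := Frag.Runs.move (Γ := Γ M) (a := .inl M.tm.k₁) (b := .inr .hR) (v := reg q sym vals buf)
    (S := stk T r) (set := fun v x => setB v (x.map M.outputAlphabet))
    (full := fun v => v.2.rb.isSome) (get := fun v => v.2.rb.getD b₀)
    (conv := M.outputAlphabet)
    (by simp) (fun _ _ _ => rfl) (fun _ x => by cases x <;> rfl) (fun _ _ => rfl)
  simp [-List.map_reverse] at this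
  exact this

end

/-! ### Evaluating an assignment -/

section Eval

variable (ℬ : RelStructure σ B)

/-- The relation `i` contains the tuple with the given list of entries. -/
def Sat (ℬ : RelStructure σ B) (i : Fin σ.m) (l : List B) : Prop :=
  ∃ t ∈ ℬ.rel i, List.ofFn t = l

open Classical in
/-- Contribution to the value of a constraint with the given symbol and values. It is `0` while
values are missing, as `Sat` fixes the length of the list. -/
noncomputable def score (sym : Option (Fin σ.m)) (l : List B) : ℕ :=
  if ∃ i, sym = some i ∧ Sat ℬ i l then 1 else 0

open Classical in
/-- If the constraint in the registers is complete and satisfied, move a tally mark from `d` to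
`dR`. If `d` is empty already, the mark on `dR` is made all the same. -/
noncomputable def scoreStmt : Stmt (Γ M) Empty (St M N L) :=
  .branch (fun v => decide (∃ i, v.2.sym = some i ∧ Sat ℬ i v.2.vals.1))
    (.pop (.inr .d) (fun v _ => v) (.push (.inr .dR) (fun _ => none) .halt)) .halt

/-- Read the next symbol of the word. At the end of the word, reset the constraint registers. -/
def readStmt : Stmt (Γ M) (CSPInput.Sym σ) (St M N L) :=
  .pop (.inr .w) setS (.branch (fun v => v.2.rs.isSome)
    (.push (.inr .wR) (fun v => v.2.rs.getD .tick) (.goto fun v => v.2.rs.getD .tick))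
    (.load (fun v => reg v.1 none .nil v.2.buf) .halt))

/-- React to a symbol of the word: a tick moves the reading position of `h` and `p` by one element,
an end marker looks up the value at this position and returns to the start, and a relation symbol
begins a new constraint. -/
noncomputable def evalSym (b₀ : B) : CSPInput.Sym σ → Frag (Γ M) (St M N L)
  | .tick => .atom <| .pop (.inr .h) setB <| .push (.inr .hR) (fun v => v.2.rb.getD b₀) <|
      .pop (.inr .p) setP <| .branch (fun v => v.2.rp.isSome)
        (.push (.inr .pR) (fun v => v.2.rp.getD none) (.load clr .halt)) (.load clr .halt)
  | .endVar => .seq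
      (.atom <| .peek (.inr .h) setB <| .peek (.inr .p) setP <|
        .load (fun v => reg v.1 v.2.sym (v.2.vals.snoc (v.2.rp.join.getD (v.2.rb.getD b₀))) v.2.buf)
          (scoreStmt ℬ))
      (.seq (moveH b₀) moveP)
  | .relSym i => .atom <| .load (fun v => reg v.1 (some i) .nil v.2.buf) (scoreStmt ℬ)

/-- Read the word of constraints and count the satisfied ones. -/
noncomputable def evalLoop (b₀ : B) : Frag (Γ M) (St M N L) := .loop readStmt (evalSym ℬ b₀)

/-- The value of a variable under the assignment `h` overridden by `p`. Beyond the end of `p` nothing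
is overridden; `b₀` is the default value beyond the end of `h`. -/
def valueAt (b₀ : B) (h : List B) (p : List (Option B)) (t : ℕ) : B :=
  p[t]?.join.getD (h[t]?.getD b₀)

variable {ℬ} {q : M.tm.σ} {sym : Option (Fin σ.m)} {vals : BoundedList B N}
  {buf : BoundedList (CSPInput.Sym σ) L} {T : ∀ k, List (M.tm.Γ k)} {b₀ : B}
  {w wR : List (CSPInput.Sym σ)} {h hR : List B} {p pR d dR e : List (Option B)}
  {v' : St M N L} {S' : ∀ k, List (Γ M k)} {n : ℕ}

theorem stepAux_scoreStmt :
    stepAux (scoreStmt (M := M) (N := N) (L := L) ℬ) (reg q sym vals buf)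
        (stk T ⟨w, wR, h, hR, p, pR, d, dR, e⟩) =
      ⟨none, reg q sym vals buf, stk T ⟨w, wR, h, hR, p, pR, d.drop (score ℬ sym vals.1),
        List.replicate (score ℬ sym vals.1) none ++ dR, e⟩⟩ := by
  by_cases hs : ∃ i, sym = some i ∧ Sat ℬ i vals.1
  · simp [stepAux, scoreStmt, reg, score, hs]
  · simp [stepAux, scoreStmt, reg, score, hs]

/-- Reading `t` ticks moves the reading position by `t`. This and the following lemmas prepend a
piece of the word to a run that starts behind it. -/
theorem eval_ticks (t : ℕ) (ht : t ≤ h.length)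
    (H : (evalLoop ℬ b₀).Runs (reg q sym vals buf)
      (stk T ⟨w, List.replicate t .tick ++ wR, h.drop t, (h.take t).reverse ++ hR, p.drop t,
        (p.take t).reverse ++ pR, d, dR, e⟩) v' S' n) :
    (evalLoop ℬ b₀).Runs (reg q sym vals buf)
      (stk T ⟨List.replicate t .tick ++ w, wR, h, hR, p, pR, d, dR, e⟩) v' S' (n + 2 * t) := by
  induction t generalizing wR h hR p pR with
  | zero => simpa using H
  | succ t ih =>
    obtain _ | ⟨x, h⟩ := h
    · simp at ht
    have hrep : List.replicate (t + 1) CSPInput.Sym.tick ++ wR =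
        List.replicate t CSPInput.Sym.tick ++ CSPInput.Sym.tick :: wR := by
      simp [List.replicate_succ']
    rw [hrep] at H
    have key : ∀ y : Option (Option B), y = p.head? →
        (evalLoop ℬ b₀).Runs (reg q sym vals buf)
          (stk T ⟨List.replicate t .tick ++ w, .tick :: wR, h, x :: hR, p.tail,
            y.toList ++ pR, d, dR, e⟩) v' S' (n + 2 * t) := by
      rintro _ rfl
      refine ih (by simpa using ht) ?_
      cases p <;> simpa using H
    refine (Frag.Runs.loop_goto (hd := readStmt) (F := evalSym ℬ b₀) (i := .tick)
      (v₁ := setS (reg q sym vals buf) (some .tick))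
      (S₁ := stk T ⟨List.replicate t .tick ++ w, .tick :: wR, x :: h, hR, p, pR, d, dR, e⟩)
      ?_ (.atom ?_) (key _ rfl)).mono (n' := n + 2 * (t + 1)) (by omega)
    · simp [stepAux, readStmt, setS, reg, List.replicate_succ]
    · cases p <;> simp [stepAux, setB, setP, setS, reg, clr]

/-- The word of a variable. -/
def entry (t : ℕ) : List (CSPInput.Sym σ) := List.replicate t .tick ++ [.endVar]

theorem eval_entry (t : ℕ) (ht : t < h.length)
    (H : (evalLoop ℬ b₀).Runs (reg q sym (vals.snoc (valueAt b₀ h p t)) buf)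
      (stk T ⟨w, (entry t).reverse ++ wR, h, [], p, [],
        d.drop (score ℬ sym (vals.snoc (valueAt b₀ h p t)).1),
        List.replicate (score ℬ sym (vals.snoc (valueAt b₀ h p t)).1) none ++ dR, e⟩) v' S' n) :
    (evalLoop ℬ b₀).Runs (reg q sym vals buf)
      (stk T ⟨entry t ++ w, wR, h, [], p, [], d, dR, e⟩) v' S'
      (n + 6 * (entry (σ := σ) t).length) := by
  have hw : entry t ++ w = List.replicate t .tick ++ CSPInput.Sym.endVar :: w := by simp [entry]
  have hwR : (entry t).reverse ++ wR =
      CSPInput.Sym.endVar :: (List.replicate t CSPInput.Sym.tick ++ wR) := by simp [entry]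
  rw [hw]
  rw [hwR] at H
  have hs := stepAux_scoreStmt (M := M) (ℬ := ℬ) (q := q) (sym := sym) (buf := buf) (T := T)
    (vals := vals.snoc (valueAt b₀ h p t)) (w := w)
    (wR := .endVar :: (List.replicate t .tick ++ wR)) (h := h.drop t)
    (hR := (h.take t).reverse) (p := p.drop t) (pR := (p.take t).reverse) (d := d) (dR := dR)
    (e := e)
  refine (eval_ticks t ht.le (Frag.Runs.loop_goto (hd := readStmt) (F := evalSym ℬ b₀)
    (i := .endVar) (n₂ := n) (v₁ := setS (reg q sym vals buf) (some .endVar))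
    (S₁ := stk T ⟨w, .endVar :: (List.replicate t .tick ++ wR), h.drop t, (h.take t).reverse,
      p.drop t, (p.take t).reverse, d, dR, e⟩)
    ?_ (.seq (.atom (Eq.trans ?_ hs)) (.seq runs_moveH runs_moveP)) ?_)).mono ?_
  · simp [stepAux, readStmt, setS, reg]
  · simp [stepAux, setB, setP, setS, reg, valueAt]
  · simpa [evalLoop] using H
  · simp [entry]
    omega

theorem eval_entries (i : Fin σ.m) (ts : List ℕ) (hts : ∀ t ∈ ts, t < h.length)
    (hi : vals.1.length + ts.length = σ.arity i) (hN : σ.arity i ≤ N)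
    (H : ∀ vals' : BoundedList B N, (evalLoop ℬ b₀).Runs (reg q (some i) vals' buf)
      (stk T ⟨w, (ts.flatMap entry).reverse ++ wR, h, [], p, [],
        d.drop (if ts = [] then 0 else score ℬ (some i) (vals.1 ++ ts.map (valueAt b₀ h p))),
        List.replicate (if ts = [] then 0 else
          score ℬ (some i) (vals.1 ++ ts.map (valueAt b₀ h p))) none ++ dR, e⟩) v' S' n) :
    (evalLoop ℬ b₀).Runs (reg q (some i) vals buf)
      (stk T ⟨ts.flatMap entry ++ w, wR, h, [], p, [], d, dR, e⟩) v' S'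
      (n + 6 * (ts.flatMap (entry (σ := σ))).length) := by
  induction ts generalizing vals wR d dR with
  | nil => simpa using H vals
  | cons t ts ih =>
    simp only [List.length_cons] at hi
    have hsnoc : (vals.snoc (valueAt b₀ h p t)).1 = vals.1 ++ [valueAt b₀ h p t] := by
      refine List.take_of_length_le ?_
      simp; omega
    simp only [List.flatMap_cons, List.append_assoc]
    refine (eval_entry t (hts t (by simp)) (ih (fun t ht => hts t (by simp [ht])) ?_ ?_)).mono ?_
    · rw [hsnoc]; simp; omega
    · intro vals'
      have := H vals'
      rw [hsnoc]
      by_cases hnil : ts = []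
      · subst hnil
        simpa using this
      · have h0 : score ℬ (some i) (vals.1 ++ [valueAt b₀ h p t]) = 0 := by
          refine if_neg ?_
          rintro ⟨j, hj, u, -, hu⟩
          obtain rfl : i = j := by simpa using hj
          have := congrArg List.length hu
          have := List.length_pos_of_ne_nil hnil
          simp at *
          omega
        simpa [h0, hnil] using this
    · simp; omega

theorem eval_constraint {m : ℕ} (c : Σ i : Fin σ.m, (Fin (σ.arity i) → Fin m))
    (hm : h.length = m) (hN : σ.arity c.1 ≤ N)
    (H : ∀ (sym' : Option (Fin σ.m)) (vals' : BoundedList B N),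
      (evalLoop ℬ b₀).Runs (reg q sym' vals' buf)
      (stk T ⟨w, (CSPInput.encodeConstraint c).reverse ++ wR, h, [], p, [],
        d.drop (score ℬ (some c.1) (List.ofFn fun j => valueAt b₀ h p (c.2 j))),
        List.replicate (score ℬ (some c.1) (List.ofFn fun j => valueAt b₀ h p (c.2 j))) none ++ dR,
        e⟩) v' S' n) :
    (evalLoop ℬ b₀).Runs (reg q sym vals buf)
      (stk T ⟨CSPInput.encodeConstraint c ++ w, wR, h, [], p, [], d, dR, e⟩) v' S'
      (n + 6 * (CSPInput.encodeConstraint c).length) := by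
  obtain ⟨i, t⟩ := c
  have henc : CSPInput.encodeConstraint ⟨i, t⟩ =
      .relSym i :: (List.ofFn fun j => (t j : ℕ)).flatMap entry := by
    have : (List.ofFn fun j => (t j : ℕ)) = (List.ofFn t).map fun v : Fin m => (v : ℕ) := by
      rw [List.map_ofFn]; rfl
    rw [this, List.flatMap_map]
    rfl
  have hs := stepAux_scoreStmt (M := M) (N := N) (ℬ := ℬ) (q := q) (sym := some i) (buf := buf)
    (T := T) (vals := .nil) (w := (List.ofFn fun j => (t j : ℕ)).flatMap entry ++ w)
    (wR := .relSym i :: wR) (h := h) (hR := []) (p := p) (pR := []) (d := d) (dR := dR) (e := e)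
  rw [henc] at H ⊢
  refine (Frag.Runs.loop_goto (hd := readStmt) (F := evalSym ℬ b₀)
    (i := .relSym i) (v₁ := setS (reg q sym vals buf) (some (.relSym i)))
    (S₁ := stk T ⟨(List.ofFn fun j => (t j : ℕ)).flatMap entry ++ w, .relSym i :: wR, h, [],
      p, [], d, dR, e⟩)
    ?_ (.atom (Eq.trans ?_ hs)) (eval_entries (n := n) i _ ?_ ?_ hN fun vals' => ?_)).mono ?_
  · simp [stepAux, readStmt, setS, reg]
  · simp [stepAux, setS, reg]
  · intro s hs
    obtain ⟨j, rfl⟩ := (List.mem_ofFn' _ _).1 hs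
    simp [hm]
  · simp [BoundedList.nil]
  · have := H (some i) vals'
    have hmap : (BoundedList.nil : BoundedList B N).1 ++
        (List.ofFn fun j => (t j : ℕ)).map (valueAt b₀ h p) =
        List.ofFn fun j => valueAt b₀ h p (t j) := by
      rw [List.map_ofFn]; rfl
    rw [hmap]
    by_cases h0 : σ.arity i = 0
    · have hnil : ∀ {A : Type} (f : Fin (σ.arity i) → A), List.ofFn f = [] := fun f => by
        simpa using h0
      simpa [hnil, BoundedList.nil] using this
    · have hs0 : score ℬ (some i) (BoundedList.nil : BoundedList B N).1 = 0 := by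
        refine if_neg ?_
        rintro ⟨j, hj, u, -, hu⟩
        obtain rfl : i = j := by simpa using hj
        simp [BoundedList.nil, h0] at hu
      have hne : List.ofFn (fun j => (t j : ℕ)) ≠ [] := by simpa using h0
      simpa [hs0, hne] using this
  · simp
    omega

end Eval

end SurAlg

/-! ### Search for the best window -/

namespace SurAlg

variable {σ : RelSignature} {B : Type} {M : TM2ComputableAux (CSPInput.Sym σ) B} {N L : ℕ}

section Search

/-- The number of constraints in the list that are satisfied by `h` overridden by `p`. -/
noncomputable def valueOf (ℬ : RelStructure σ B) (b₀ : B) {m : ℕ}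
    (cs : List (Σ i : Fin σ.m, (Fin (σ.arity i) → Fin m))) (h : List B) (p : List (Option B)) : ℕ :=
  (cs.map fun c => score ℬ (some c.1) (List.ofFn fun j => valueAt b₀ h p (c.2 j))).sum

variable (ℬ : RelStructure σ B)

/-- If the best tally is exhausted, the current override is the best one: clear `e`. -/
def compare : Frag (Γ M) (St M N L) :=
  .cases (.peek (.inr .d) setP <| .branch (fun v => v.2.rp.isNone) (.goto fun _ => ())
    (.load clr .halt)) fun _ : Unit => .clear (.inr .e) setP fun v => v.2.rp.isSome

/-- Evaluate the current override and update the best one. -/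
noncomputable def round (b₀ : B) : Frag (Γ M) (St M N L) :=
  (evalLoop ℬ b₀).seq <| moveW.seq <| compare.seq moveD

/-- Evaluate all overrides that are obtained by removing `none`s from the front of `p`. -/
noncomputable def search (b₀ : B) : Frag (Γ M) (St M N L) :=
  .loop (.pop (.inr .p) setP <| .branch (fun v => v.2.rp.any Option.isNone)
    (.push (.inr .e) (fun _ => none) <| .load clr <| .goto fun _ => ())
    (.push (.inr .p) (fun v => v.2.rp.getD none) <| .load clr .halt)) fun _ : Unit => round ℬ b₀

variable {ℬ} {q : M.tm.σ} {sym : Option (Fin σ.m)} {vals : BoundedList B N}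
  {buf : BoundedList (CSPInput.Sym σ) L} {T : ∀ k, List (M.tm.Γ k)} {b₀ : B}
  {w wR : List (CSPInput.Sym σ)} {h hR : List B} {p pR d dR e : List (Option B)}
  {v' : St M N L} {S' : ∀ k, List (Γ M k)} {n : ℕ} {m : ℕ}
  {cs : List (Σ i : Fin σ.m, (Fin (σ.arity i) → Fin m))}

/-- Evaluation leaves on `d` what remains of the best tally, and on `dR` the value of the override.
-/
theorem runs_evalLoop (hm : h.length = m) (hN : ∀ i, σ.arity i ≤ N) :
    (evalLoop ℬ b₀).Runs (reg q sym vals buf)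
      (stk T ⟨cs.flatMap CSPInput.encodeConstraint, wR, h, [], p, [], d, dR, e⟩)
      (reg q none .nil buf)
      (stk T ⟨[], (cs.flatMap CSPInput.encodeConstraint).reverse ++ wR, h, [], p, [],
        d.drop (valueOf ℬ b₀ cs h p), List.replicate (valueOf ℬ b₀ cs h p) none ++ dR, e⟩)
      (6 * (cs.flatMap CSPInput.encodeConstraint).length + 1) := by
  induction cs generalizing sym vals wR d dR with
  | nil => exact .loop_halt (by simp [stepAux, readStmt, setS, reg, valueOf])
  | cons c cs ih =>
    simp only [List.flatMap_cons]
    refine (eval_constraint c hm (hN _) fun sym' vals' => ?_).mono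
      (n := 6 * (cs.flatMap CSPInput.encodeConstraint).length + 1 + _) ?_
    · convert ih using 2
      simp only [valueOf, List.map_cons, List.sum_cons, List.reverse_append, List.append_assoc,
        List.drop_drop]
      congr 1
      rw [add_comm, ← List.replicate_append_replicate, List.append_assoc]
    · simp
      omega

theorem valueOf_le : valueOf ℬ b₀ cs h p ≤ (cs.flatMap CSPInput.encodeConstraint).length := by
  induction cs with
  | nil => simp [valueOf]
  | cons c cs ih =>
    have h1 : score ℬ (some c.1) (List.ofFn fun j => valueAt b₀ h p (c.2 j)) ≤ 1 := by
      unfold score; split <;> simp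
    have h2 : 1 ≤ (CSPInput.encodeConstraint c).length := by simp [CSPInput.encodeConstraint]
    simp [valueOf] at ih h1 ⊢
    omega

theorem runs_compare {d : List (Option B)} :
    compare.Runs (reg q sym vals buf) (stk T ⟨w, wR, h, hR, p, pR, d, dR, e⟩)
      (reg q sym vals buf) (stk T ⟨w, wR, h, hR, p, pR, d, dR, if d = [] then [] else e⟩)
      (2 * e.length + 2) := by
  rcases d with _ | ⟨x, d⟩
  · have := Frag.Runs.clear (Γ := Γ M) (a := .inr .e) (v := reg q sym vals buf)
      (S := stk T ⟨w, wR, h, hR, p, pR, [], dR, e⟩) (set := setP)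
      (full := fun v => v.2.rp.isSome) (fun _ _ _ => rfl) (fun _ _ => rfl)
    simp at this
    exact .cases_goto (by simp [stepAux, setP, reg]; rfl) this
  · exact (Frag.Runs.cases_halt (by simp [stepAux, setP, reg, clr])).mono (by omega)

theorem runs_round {best : ℕ} (hm : h.length = m) (hN : ∀ i, σ.arity i ≤ N)
    (hw : cs.flatMap CSPInput.encodeConstraint = w) :
    (round (N := N) ℬ b₀).Runs (reg q none .nil buf)
      (stk T ⟨w, [], h, [], p, [], List.replicate best none, [], e⟩) (reg q none .nil buf)
      (stk T ⟨w, [], h, [], p, [], List.replicate (max best (valueOf ℬ b₀ cs h p)) none, [],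
        if best ≤ valueOf ℬ b₀ cs h p then [] else e⟩) (10 * w.length + 2 * e.length + 5) := by
  subst hw
  refine ((runs_evalLoop hm hN).seq (.seq runs_moveW (.seq runs_compare runs_moveD))).congr ?_ ?_
  · have h1 : List.replicate (valueOf ℬ b₀ cs h p) (none : Option B) ++
        List.replicate (best - valueOf ℬ b₀ cs h p) none =
        List.replicate (max best (valueOf ℬ b₀ cs h p)) none := by
      rw [List.replicate_append_replicate]
      congr 1
      omega
    have h2 : List.replicate (best - valueOf ℬ b₀ cs h p) (none : Option B) = [] ↔
        best ≤ valueOf ℬ b₀ cs h p := by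
      simp [Nat.sub_eq_zero_iff_le]
    simp [h1, h2]
  · have := valueOf_le (ℬ := ℬ) (b₀ := b₀) (cs := cs) (h := h) (p := p)
    simp [-List.length_flatMap]
    omega

/-- The search loop with `J` windows left out of `J₀`. Its invariant: the value of every window
tried is at most `best`, and `best` is the value of the window at `J + x`. In the end, `x'` is the
position of a best window. -/
theorem runs_search {J₀ : ℕ} {P : List (Option B)} (hm : h.length = m) (hN : ∀ i, σ.arity i ≤ N)
    (hw : cs.flatMap CSPInput.encodeConstraint = w) (hP : ∃ b P', P = some b :: P') (J best x : ℕ)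
    (hJ : J + x ≤ J₀) (h₀ : J = J₀ → best = 0)
    (hx : J < J₀ → J + x < J₀ ∧ best = valueOf ℬ b₀ cs h (List.replicate (J + x) none ++ P))
    (hbest : ∀ j, J ≤ j → j < J₀ → valueOf ℬ b₀ cs h (List.replicate j none ++ P) ≤ best) :
    ∃ best' x', x' ≤ J₀ ∧ best' ≤ w.length ∧
      (0 < J₀ → x' < J₀ ∧ ∀ j < J₀, valueOf ℬ b₀ cs h (List.replicate j none ++ P) ≤
        valueOf ℬ b₀ cs h (List.replicate x' none ++ P)) ∧
      (search (N := N) ℬ b₀).Runs (reg q none .nil buf)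
        (stk T ⟨w, [], h, [], List.replicate J none ++ P, [], List.replicate best none, [],
          List.replicate x none⟩) (reg q none .nil buf)
        (stk T ⟨w, [], h, [], P, [], List.replicate best' none, [], List.replicate x' none⟩)
        (J * (10 * w.length + 2 * J₀ + 6) + 1) := by
  induction J generalizing best x with
  | zero =>
    refine ⟨best, x, by omega, ?_, ?_, ?_⟩
    · rcases Nat.eq_zero_or_pos J₀ with h0 | h0
      · simp [h₀ h0.symm]
      · rw [(hx h0).2, ← hw]
        exact valueOf_le
    · intro h0
      obtain ⟨h1, h2⟩ := hx h0
      refine ⟨by omega, fun j hj => (hbest j (Nat.zero_le _) hj).trans ?_⟩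
      rw [h2, zero_add]
    · obtain ⟨b, P', rfl⟩ := hP
      exact (Frag.Runs.loop_halt (by simp [stepAux, setP, reg, clr])).mono (by omega)
  | succ J ih =>
    set f := fun j => valueOf ℬ b₀ cs h (List.replicate j none ++ P) with hf
    have hround := runs_round (ℬ := ℬ) (M := M) (L := L) (q := q) (buf := buf) (T := T) (b₀ := b₀)
      (p := List.replicate J none ++ P) (e := List.replicate (x + 1) none) (best := best) hm hN hw
    change (round ℬ b₀).Runs _ _ _ (stk T ⟨w, [], h, [], _, [],
      List.replicate (max best (f J)) none, [], if best ≤ f J then [] else _⟩) _ at hround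
    have hif : (if best ≤ f J then [] else List.replicate (x + 1) (none : Option B)) =
        List.replicate (if best ≤ f J then 0 else x + 1) none := by
      split <;> simp
    rw [hif] at hround
    obtain ⟨best', x', h1, h2, h3, h4⟩ := ih (max best (f J)) (if best ≤ f J then 0 else x + 1)
      (by split <;> omega) (by omega)
      (by
        intro _
        split
        · rename_i hle
          exact ⟨by omega, (max_eq_right hle).trans (by simp [hf])⟩
        · rename_i hle
          have hlt : J + 1 < J₀ := by
            rcases (show J + 1 ≤ J₀ by omega).lt_or_eq with h | h
            · exact h
            · rw [h₀ h] at hle; simp at hle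
          obtain ⟨h5, h6⟩ := hx hlt
          refine ⟨by omega, ?_⟩
          rw [max_eq_left (by omega), h6]
          congr 3
          omega)
      (by
        intro j hj hj'
        rcases hj.eq_or_lt with rfl | hj
        · exact le_max_right _ _
        · exact (hbest j hj hj').trans (le_max_left _ _))
    refine ⟨best', x', h1, h2, h3, ?_⟩
    refine (Frag.Runs.loop_goto (i := ()) ?_ hround h4).mono ?_
    · simp [stepAux, setP, reg, clr, List.replicate_succ]
    · simp only [List.length_replicate]
      ring_nf
      omega

end Search

end SurAlg

/-! ### The machine -/

namespace SurAlg

variable {σ : RelSignature} {B : Type} {M : TM2ComputableAux (CSPInput.Sym σ) B} {N L : ℕ}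

section Program

/-- Execute a statement of `M` on the stacks of `M` within the combined machine. -/
def liftStmt {Λ : Type} : Stmt M.tm.Γ Λ M.tm.σ → Stmt (Γ M) Λ (St M N L)
  | .push k f q => .push (.inl k) (fun v => f v.1) (liftStmt q)
  | .peek k f q => .peek (.inl k) (fun v x => (f v.1 x, v.2)) (liftStmt q)
  | .pop k f q => .pop (.inl k) (fun v x => (f v.1 x, v.2)) (liftStmt q)
  | .load f q => .load (fun v => (f v.1, v.2)) (liftStmt q)
  | .branch c q₁ q₂ => .branch (fun v => c v.1) (liftStmt q₁) (liftStmt q₂)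
  | .goto l => .goto fun v => l v.1
  | .halt => .halt

/-- The machine `M` as a fragment of the combined machine. -/
def runM : Frag (Γ M) (St M N L) := ⟨M.tm.Λ, M.tm.ΛFin, M.tm.main, fun l => liftStmt (M.tm.m l)⟩

/-- The stacks of `M` of which only `k` is nonempty. -/
def single (k : M.tm.K) (l : List (M.tm.Γ k)) : ∀ k, List (M.tm.Γ k) :=
  Function.update (fun _ => []) k l

/-- Move the input to `wR` and keep a prefix of it in the finite memory. -/
def readInput : Frag (Γ M) (St M N L) :=
  .iter <| .pop (.inl M.tm.k₀) (fun v x => setS v (x.map M.inputAlphabet)) <|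
    .branch (fun v => v.2.rs.isSome)
      (.push (.inr .wR) (fun v => v.2.rs.getD .tick) <|
        .load (fun v => reg v.1 v.2.sym v.2.vals (v.2.buf.snoc (v.2.rs.getD .tick))) <|
        .goto fun _ => ()) .halt

/-- Copy `wR` to `w` and to the input stack of `M`. -/
def copyInput : Frag (Γ M) (St M N L) :=
  .iter <| .pop (.inr .wR) setS <| .branch (fun v => v.2.rs.isSome)
    (.push (.inr .w) (fun v => v.2.rs.getD .tick) <|
      .push (.inl M.tm.k₀) (fun v => M.inputAlphabet.symm (v.2.rs.getD .tick)) <|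
      .load clr <| .goto fun _ => ()) .halt

/-- Remove the leading ticks of `w`, and push `none` onto `p` for each of them. -/
def strip : Frag (Γ M) (St M N L) :=
  .iter <| .pop (.inr .w) setS <|
    .branch (fun v => match v.2.rs with | some .tick => true | _ => false)
      (.push (.inr .p) (fun _ => none) <| .load clr <| .goto fun _ => ()) <|
      .branch (fun v => v.2.rs.isSome)
        (.push (.inr .w) (fun v => v.2.rs.getD .tick) <| .load clr .halt) .halt

/-- Override `h` by `p`; the result appears reversed on `hR`. -/
def override (b₀ : B) : Frag (Γ M) (St M N L) :=
  .iter <| .pop (.inr .h) setB <| .branch (fun v => v.2.rb.isSome)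
    (.pop (.inr .p) setP <| .push (.inr .hR) (fun v => v.2.rp.join.getD (v.2.rb.getD b₀)) <|
      .load clr <| .goto fun _ => ()) .halt

/-- Move `hR` to the output stack. -/
def writeOutput (b₀ : B) : Frag (Γ M) (St M N L) :=
  .move (.inr .hR) (.inl M.tm.k₁) setB (fun v => v.2.rb.isSome)
    fun v => M.outputAlphabet.symm (v.2.rb.getD b₀)

/-- Clear `w`. -/
def clearW : Frag (Γ M) (St M N L) := .clear (.inr .w) setS fun v => v.2.rs.isSome
/-- Clear `wR`. -/
def clearWR : Frag (Γ M) (St M N L) := .clear (.inr .wR) setS fun v => v.2.rs.isSome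
/-- Clear `d`. -/
def clearD : Frag (Γ M) (St M N L) := .clear (.inr .d) setP fun v => v.2.rp.isSome

/-- The treatment of the words that are shorter than `L`: the output is the entry of the table
`ans`. -/
def short (ans : List (CSPInput.Sym σ) → List B) (u : BoundedList (CSPInput.Sym σ) L) :
    Frag (Γ M) (St M N L) :=
  clearWR.seq <| .atom <| .load (fun v => reg v.1 none .nil .nil) <|
    .pushList (.inl M.tm.k₁) ((ans u.1).map M.outputAlphabet.symm) .halt

/-- The treatment of the other words: run `M`, then override its output on the best window. The list
`bs` enumerates `B`; of the `none`s pushed by `strip`, `|bs| - 1` are removed again, as the last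
window ends at the last position. -/
noncomputable def long (ℬ : RelStructure σ B) (b₀ : B) (bs : List B) : Frag (Γ M) (St M N L) :=
  (Frag.atom <| .load (fun v => reg v.1 none .nil .nil) <|
    .pushList (.inr .p) (bs.map some) .halt).seq <|
  copyInput.seq <| runM.seq <| (moveOut b₀).seq <| (moveH b₀).seq <| strip.seq <|
  (Frag.atom <| .popMany (.inr .p) (bs.length - 1) .halt).seq <| (search ℬ b₀).seq <|
  moveE.seq <| (override b₀).seq <| (writeOutput b₀).seq <| clearW.seq clearD

/-- The whole algorithm. -/
noncomputable def alg [Finite B] (ℬ : RelStructure σ B) (b₀ : B) (bs : List B)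
    (ans : List (CSPInput.Sym σ) → List B) : Frag (Γ M) (St M N L) :=
  readInput.seq <| .cases
    (.goto fun v => if v.2.buf.1.length < L then some v.2.buf else none)
    fun u : Option (BoundedList (CSPInput.Sym σ) L) => u.elim (long ℬ b₀ bs) (short ans)

/-- The machine that executes `alg`. -/
noncomputable def machine [Finite B] (M : TM2ComputableAux (CSPInput.Sym σ) B) (N L : ℕ)
    (ℬ : RelStructure σ B) (b₀ : B) (bs : List B) (ans : List (CSPInput.Sym σ) → List B) :
    TM2ComputableAux (CSPInput.Sym σ) B where
  tm :=
    letI := M.tm.kFin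
    letI := M.tm.σFin
    letI := M.tm.Γk₀Fin
    letI : Fintype (Reg σ B N L) := .ofFinite _
    letI := (alg (M := M) (N := N) (L := L) ℬ b₀ bs ans).fin
    { K := M.tm.K ⊕ WorkStack
      k₀ := .inl M.tm.k₀
      k₁ := .inl M.tm.k₁
      Γ := Γ M
      Λ := (alg (M := M) (N := N) (L := L) ℬ b₀ bs ans).Λ
      main := (alg (M := M) (N := N) (L := L) ℬ b₀ bs ans).main
      σ := St M N L
      initialState := reg M.tm.initialState none .nil .nil
      m := (alg ℬ b₀ bs ans).m }
  inputAlphabet := M.inputAlphabet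
  outputAlphabet := M.outputAlphabet

variable {ℬ : RelStructure σ B} {q : M.tm.σ} {sym : Option (Fin σ.m)} {vals : BoundedList B N}
  {buf : BoundedList (CSPInput.Sym σ) L} {T : ∀ k, List (M.tm.Γ k)} {b₀ : B} {bs : List B}
  {u w wR : List (CSPInput.Sym σ)} {h hR : List B} {p pR d dR e : List (Option B)}

theorem stepAux_liftStmt {Λ : Type} (s : Stmt M.tm.Γ Λ M.tm.σ) (r : Reg σ B N L) (W : Work σ B) :
    stepAux (liftStmt s) (q, r) (stk T W) = ⟨(stepAux s q T).l, ((stepAux s q T).var, r),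
      stk (stepAux s q T).stk W⟩ := by
  induction s generalizing q T with
  | branch c s₁ s₂ ih₁ ih₂ =>
    simp only [liftStmt, stepAux]
    cases c q
    exacts [ih₂, ih₁]
  | goto l => rfl
  | halt => rfl
  | load f s ih => exact ih
  | _ k f s ih =>
    simp only [liftStmt, stepAux, update_inl, stk_inl]
    exact ih

/-- The combined machine simulates `M` step by step. -/
theorem runs_runM {l : List (M.tm.Γ M.tm.k₀)} {l' : List (M.tm.Γ M.tm.k₁)} {n : ℕ}
    (H : TM2OutputsInTime M.tm l (some l') n) {r : Reg σ B N L} {W : Work σ B} :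
    runM.Runs (M.tm.initialState, r) (stk (single M.tm.k₀ l) W) (M.tm.initialState, r)
      (stk (single M.tm.k₁ l') W) n := by
  have key : ∀ n (a b : M.tm.Cfg), StepsTo M.tm.step n a b →
      StepsTo (step (runM (M := M) (N := N) (L := L)).m) n ⟨a.l, (a.var, r), stk a.stk W⟩
        ⟨b.l, (b.var, r), stk b.stk W⟩ := by
    intro n a b hab
    induction hab with
    | refl a => exact .refl _
    | @head n a b c hab _ ih =>
      refine .head ?_ ih
      obtain ⟨_ | l, v, S⟩ := a
      · simp [step] at hab
      · obtain rfl : stepAux (M.tm.m l) v S = b := Option.some.inj hab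
        exact congrArg some (stepAux_liftStmt _ _ _)
  have hs := StepsTo.iff_iterate.2 H.evals_in_steps
  have h0 : (initList M.tm l).stk = single M.tm.k₀ l := by
    funext k
    by_cases hk : k = M.tm.k₀
    · subst hk; simp [initList, single]
    · simp [initList, single, hk]
  have h1 : (haltList M.tm l').stk = single M.tm.k₁ l' := by
    funext k
    by_cases hk : k = M.tm.k₁
    · subst hk; simp [haltList, single]
    · simp [haltList, single, hk]
  have := key _ _ _ hs
  rw [h0, h1] at this
  exact ⟨H.steps, H.steps_le_m, this⟩

theorem take_append_take {A : Type} (n : ℕ) (l l' : List A) :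
    (l.take n ++ l').take n = (l ++ l').take n := by
  rcases le_total l.length n with hl | hl
  · rw [List.take_of_length_le hl]
  · rw [List.take_append_of_le_length hl, List.take_append_of_le_length (by simp [hl])]
    simp

theorem runs_readInput (l : List (M.tm.Γ M.tm.k₀)) (hbuf : buf.1.length ≤ L) :
    ∃ buf' : BoundedList (CSPInput.Sym σ) L,
      buf'.1 = (buf.1 ++ l.map M.inputAlphabet).take L ∧
      readInput.Runs (reg q sym vals buf)
        (stk (single M.tm.k₀ l) ⟨w, wR, h, hR, p, pR, d, dR, e⟩) (reg q sym vals buf')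
        (stk (fun _ => []) ⟨w, (l.map M.inputAlphabet).reverse ++ wR, h, hR, p, pR, d, dR, e⟩)
        (2 * l.length + 1) := by
  induction l generalizing buf wR with
  | nil =>
    refine ⟨buf, by simp [List.take_of_length_le buf.2], .iter_halt ?_⟩
    simp [stepAux, setS, reg, single]
  | cons x l ih =>
    obtain ⟨buf', h1, h2⟩ := ih (buf := buf.snoc (M.inputAlphabet x))
      (wR := M.inputAlphabet x :: wR) (BoundedList.snoc buf _).2
    refine ⟨buf', ?_, (Frag.Runs.iter_goto ?_ h2).congr ?_ ?_⟩
    · rw [h1]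
      rw [BoundedList.snoc, take_append_take, List.append_assoc]
      rfl
    · simp [stepAux, setS, reg, single]
    · simp
    · simp; omega

theorem runs_copyInput : copyInput.Runs (reg q sym vals buf)
    (stk (single M.tm.k₀ (w.map M.inputAlphabet.symm)) ⟨w, wR, h, hR, p, pR, d, dR, e⟩)
    (reg q sym vals buf)
    (stk (single M.tm.k₀ ((wR.reverse ++ w).map M.inputAlphabet.symm))
      ⟨wR.reverse ++ w, [], h, hR, p, pR, d, dR, e⟩) (2 * wR.length + 1) := by
  induction wR generalizing w with
  | nil => exact .iter_halt (by simp [stepAux, setS, reg])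
  | cons x wR ih =>
    refine (Frag.Runs.iter_goto ?_ (ih (w := x :: w))).congr ?_ ?_
    · simp [stepAux, setS, reg, clr, single]
    · simp
    · simp; omega

theorem runs_strip {m : ℕ} (hw : w.head? ≠ some .tick) : strip.Runs (reg q sym vals buf)
    (stk T ⟨List.replicate m .tick ++ w, wR, h, hR, p, pR, d, dR, e⟩) (reg q sym vals buf)
    (stk T ⟨w, wR, h, hR, List.replicate m none ++ p, pR, d, dR, e⟩) (2 * m + 1) := by
  induction m generalizing p with
  | zero =>
    rcases w with _ | ⟨_ | _ | i, w⟩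
    · exact .iter_halt (by simp [stepAux, setS, reg])
    · simp at hw
    · exact .iter_halt (by simp [stepAux, setS, reg, clr])
    · exact .iter_halt (by simp [stepAux, setS, reg, clr])
  | succ m ih =>
    refine (Frag.Runs.iter_goto ?_
      (ih (p := none :: p))).congr ?_ ?_
    · simp [stepAux, setS, reg, clr, List.replicate_succ]
    · rw [List.replicate_succ', List.append_assoc]
      rfl
    · omega

theorem runs_override : (override b₀).Runs (reg q sym vals buf)
    (stk T ⟨w, wR, h, hR, p, pR, d, dR, e⟩) (reg q sym vals buf)
    (stk T ⟨w, wR, [], ((List.range h.length).map (valueAt b₀ h p)).reverse ++ hR,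
      p.drop h.length, pR, d, dR, e⟩) (2 * h.length + 1) := by
  induction h generalizing hR p with
  | nil => exact .iter_halt (by simp [stepAux, setB, reg])
  | cons x h ih =>
    refine (Frag.Runs.iter_goto ?_ (ih (hR := p.head?.join.getD x :: hR) (p := p.tail))).congr ?_ ?_
    · simp [stepAux, setB, setP, clr, reg]
    · have h0 : valueAt b₀ (x :: h) p 0 = p.head?.join.getD x := by
        simp [valueAt, List.head?_eq_getElem?]
      have h1 : valueAt b₀ (x :: h) p ∘ Nat.succ = valueAt b₀ h p.tail := by
        funext t; simp [valueAt]
      simp [List.range_succ_eq_map, h0, h1]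
    · simp; omega

theorem runs_writeOutput {r : Work σ B} : (writeOutput b₀).Runs (reg q sym vals buf)
    (stk (fun _ => []) r) (reg q sym vals buf)
    (stk (single M.tm.k₁ (r.hR.reverse.map M.outputAlphabet.symm)) { r with hR := [] })
    (2 * r.hR.length + 1) := by
  have := Frag.Runs.move (Γ := Γ M) (a := .inr .hR) (b := .inl M.tm.k₁) (v := reg q sym vals buf)
    (S := stk (fun _ => []) r) (set := setB) (full := fun v => v.2.rb.isSome)
    (get := fun v => M.outputAlphabet.symm (v.2.rb.getD b₀)) (conv := M.outputAlphabet.symm)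
    (by simp) (fun _ _ _ => rfl) (fun _ _ => rfl) (fun _ _ => rfl)
  simp [-List.map_reverse] at this
  exact this

theorem runs_clearW {r : Work σ B} : clearW.Runs (reg q sym vals buf) (stk T r)
    (reg q sym vals buf) (stk T { r with w := [] }) (2 * r.w.length + 1) := by
  have := Frag.Runs.clear (Γ := Γ M) (a := .inr .w) (v := reg q sym vals buf) (S := stk T r)
    (set := setS) (full := fun v => v.2.rs.isSome) (fun _ _ _ => rfl) (fun _ _ => rfl)
  simp at this
  exact this

theorem runs_clearWR {r : Work σ B} : clearWR.Runs (reg q sym vals buf) (stk T r)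
    (reg q sym vals buf) (stk T { r with wR := [] }) (2 * r.wR.length + 1) := by
  have := Frag.Runs.clear (Γ := Γ M) (a := .inr .wR) (v := reg q sym vals buf) (S := stk T r)
    (set := setS) (full := fun v => v.2.rs.isSome) (fun _ _ _ => rfl) (fun _ _ => rfl)
  simp at this
  exact this

theorem runs_clearD {r : Work σ B} : clearD.Runs (reg q sym vals buf) (stk T r)
    (reg q sym vals buf) (stk T { r with d := [] }) (2 * r.d.length + 1) := by
  have := Frag.Runs.clear (Γ := Γ M) (a := .inr .d) (v := reg q sym vals buf) (S := stk T r)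
    (set := setP) (full := fun v => v.2.rp.isSome) (fun _ _ _ => rfl) (fun _ _ => rfl)
  simp at this
  exact this

/-- The empty work stacks. -/
def Work.empty : Work σ B := ⟨[], [], [], [], [], [], [], [], []⟩

theorem runs_short {ans : List (CSPInput.Sym σ) → List B} {u : BoundedList (CSPInput.Sym σ) L} :
    (short (N := N) ans u).Runs (reg q none .nil buf)
      (stk (fun _ => []) ⟨[], wR, [], [], [], [], [], [], []⟩) (reg q none .nil .nil)
      (stk (single M.tm.k₁ ((ans u.1).map M.outputAlphabet.symm)) Work.empty)
      (2 * wR.length + 2) := by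
  refine (runs_clearWR.seq (.atom ?_)).congr rfl ?_
  · simp only [stepAux, stepAux_pushList, update_inl]
    simp [reg, single, Work.empty]
  · simp

theorem head?_flatMap_encodeConstraint_ne {m : ℕ}
    (cs : List (Σ i : Fin σ.m, (Fin (σ.arity i) → Fin m))) :
    (cs.flatMap CSPInput.encodeConstraint).head? ≠ some .tick := by
  cases cs <;> simp [CSPInput.encodeConstraint]

theorem runs_long {n τ : ℕ} {cs : List (Σ i : Fin σ.m, (Fin (σ.arity i) → Fin n))}
    (hN : ∀ i, σ.arity i ≤ N) (hbs : bs ≠ []) (hn : bs.length ≤ n) (hh : h.length = n)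
    (hu : u = List.replicate n .tick ++ cs.flatMap CSPInput.encodeConstraint)
    (hM : TM2OutputsInTime M.tm (u.map M.inputAlphabet.symm)
      (some (h.map M.outputAlphabet.symm)) τ) :
    ∃ x < n - (bs.length - 1),
      (∀ j < n - (bs.length - 1), valueOf ℬ b₀ cs h (List.replicate j none ++ bs.map some) ≤
        valueOf ℬ b₀ cs h (List.replicate x none ++ bs.map some)) ∧
      (long (N := N) ℬ b₀ bs).Runs (reg M.tm.initialState none .nil buf)
        (stk (fun _ => []) ⟨[], u.reverse, [], [], [], [], [], [], []⟩)
        (reg M.tm.initialState none .nil .nil)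
        (stk (single M.tm.k₁ (((List.range n).map
          (valueAt b₀ h (List.replicate x none ++ bs.map some))).map M.outputAlphabet.symm))
          Work.empty)
        (τ + u.length * (12 * u.length + 6) + 18 * u.length + 20) := by
  set w := cs.flatMap CSPInput.encodeConstraint with hw
  have hul : u.length = n + w.length := by rw [hu]; simp
  have hpos := List.length_pos_of_ne_nil hbs
  obtain ⟨b, bs', rfl⟩ := List.exists_cons_of_ne_nil hbs
  -- Only the first `n - |bs| + 1` windows lie within the `n` positions.
  set J₀ := n - ((b :: bs').length - 1) with hJ₀
  set P := (b :: bs').map some with hP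
  have hPl : P.length = (b :: bs').length := by simp [hP]
  obtain ⟨best, x, -, hbest, hx, hsearch⟩ := runs_search (M := M) (L := L) (ℬ := ℬ)
    (q := M.tm.initialState) (buf := .nil) (T := fun _ => []) (b₀ := b₀) (J₀ := J₀) hh hN hw.symm
    (P := P) ⟨b, _, List.map_cons⟩ J₀ 0 0 (by omega) (fun _ => rfl) (fun h => absurd h (by omega))
    (fun j h1 h2 => by omega)
  obtain ⟨hx1, hx2⟩ := hx (by omega)
  refine ⟨x, hx1, hx2, ?_⟩
  have h1 : (Frag.atom (.load (fun v : St M N L => reg v.1 none .nil .nil)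
      (.pushList (.inr .p) P .halt))).Runs (reg M.tm.initialState none .nil buf)
      (stk (fun _ => []) ⟨[], u.reverse, [], [], [], [], [], [], []⟩)
      (reg M.tm.initialState none .nil .nil)
      (stk (single M.tm.k₀ (([] : List (CSPInput.Sym σ)).map M.inputAlphabet.symm))
        ⟨[], u.reverse, [], [], P, [], [], [], []⟩) 1 := by
    refine .atom ?_
    simp only [stepAux, stepAux_pushList, update_p]
    simp [reg, single]
  have h2 := runs_copyInput (M := M) (N := N) (q := M.tm.initialState) (sym := none) (vals := .nil)
    (buf := (.nil : BoundedList _ L)) (w := []) (wR := u.reverse) (h := []) (hR := []) (p := P)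
    (pR := []) (d := []) (dR := []) (e := [])
  simp only [List.reverse_reverse, List.append_nil] at h2
  have h3 := runs_runM hM (N := N) (r := ⟨none, none, none, none, .nil, (.nil : BoundedList _ L)⟩)
    (W := ⟨u, [], [], [], P, [], [], [], []⟩)
  have h4 := (runs_moveOut (M := M) (N := N) (b₀ := b₀) (q := M.tm.initialState) (sym := none)
    (vals := .nil) (buf := (.nil : BoundedList _ L))
    (T := single M.tm.k₁ (h.map M.outputAlphabet.symm))
    (r := ⟨u, [], [], [], P, [], [], [], []⟩)).congr
    (S'' := stk (fun _ => []) ⟨u, [], [], h.reverse, P, [], [], [], []⟩) (n' := 2 * n + 1)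
    (by simp [single, List.map_reverse, Function.comp_def]) (by simp [single, hh])
  have h5 := (runs_moveH (M := M) (N := N) (b₀ := b₀) (q := M.tm.initialState) (sym := none)
    (vals := .nil) (buf := (.nil : BoundedList _ L)) (T := fun _ => [])
    (r := ⟨u, [], [], h.reverse, P, [], [], [], []⟩)).congr
    (S'' := stk (fun _ => []) ⟨List.replicate n .tick ++ w, [], h, [], P, [], [], [], []⟩)
    (n' := 2 * n + 1) (by simp [hu]) (by simp [hh])
  have h6 := runs_strip (M := M) (N := N) (q := M.tm.initialState) (sym := none) (vals := .nil)
    (buf := (.nil : BoundedList _ L)) (T := fun _ => []) (w := w) (wR := []) (h := h) (hR := [])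
    (p := P) (pR := []) (d := []) (dR := []) (e := []) (m := n)
    (head?_flatMap_encodeConstraint_ne cs)
  have h7 : (Frag.atom (.popMany (.inr .p) ((b :: bs').length - 1) .halt) :
      Frag (Γ M) (St M N L)).Runs
      (reg M.tm.initialState none (.nil : BoundedList B N) (.nil : BoundedList _ L))
      (stk (fun _ => []) ⟨w, [], h, [], List.replicate n none ++ P, [], [], [], []⟩)
      (reg M.tm.initialState none .nil .nil)
      (stk (fun _ => []) ⟨w, [], h, [], List.replicate J₀ none ++ P, [], List.replicate 0 none, [],
        List.replicate 0 none⟩) 1 := by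
    refine .atom ?_
    simp only [stepAux_popMany, stepAux, stk_p, update_p]
    rw [List.drop_append_of_le_length (by simp; simp at hn; omega)]
    simp [hJ₀]
  have h8 := (runs_moveE (M := M) (N := N) (q := M.tm.initialState) (sym := none)
    (vals := .nil) (buf := (.nil : BoundedList _ L)) (T := fun _ => [])
    (r := ⟨w, [], h, [], P, [], List.replicate best none, [], List.replicate x none⟩)).congr
    (S'' := stk (fun _ => []) ⟨w, [], h, [], List.replicate x none ++ P, [],
      List.replicate best none, [], []⟩)
    (n' := 2 * x + 1) (by simp) (by simp)
  have h9 := (runs_override (M := M) (N := N) (b₀ := b₀) (q := M.tm.initialState) (sym := none)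
    (vals := .nil) (buf := (.nil : BoundedList _ L)) (T := fun _ => []) (w := w) (wR := [])
    (h := h) (hR := []) (p := List.replicate x none ++ P) (pR := []) (d := List.replicate best none)
    (dR := []) (e := [])).congr
    (S'' := stk (fun _ => []) ⟨w, [], [], ((List.range n).map
      (valueAt b₀ h (List.replicate x none ++ P))).reverse, [], [], List.replicate best none, [],
      []⟩)
    (n' := 2 * n + 1)
    (by
      rw [List.drop_eq_nil_of_le (by simp [hPl]; simp at hn hJ₀; omega)]
      simp [hh]) (by rw [hh])
  refine (h1.seq (h2.seq (h3.seq (h4.seq (h5.seq (h6.seq (h7.seq (hsearch.seq (h8.seq (h9.seq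
    (runs_writeOutput.seq (runs_clearW.seq runs_clearD)))))))))))).congr ?_ ?_
  · simp [Work.empty]
  · simp only [List.length_reverse, List.length_map, List.length_range, List.length_replicate]
    have hJu : J₀ ≤ u.length := by omega
    have : J₀ * (10 * w.length + 2 * J₀ + 6) ≤ u.length * (12 * u.length + 6) :=
      Nat.mul_le_mul hJu (by omega)
    omega

/-- A run of the program that ends with only the output left is a computation of the machine. -/
theorem machine_outputsInTime [Finite B] {ans : List (CSPInput.Sym σ) → List B} {l : List B}
    {t : ℕ} (H : (alg ℬ b₀ bs ans).Runs (reg M.tm.initialState none (.nil : BoundedList B N) .nil)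
      (stk (single M.tm.k₀ (u.map M.inputAlphabet.symm)) Work.empty)
      (reg M.tm.initialState none .nil (.nil : BoundedList _ L))
      (stk (single M.tm.k₁ (l.map M.outputAlphabet.symm)) Work.empty) t) :
    Nonempty (TM2OutputsInTime (machine M N L ℬ b₀ bs ans).tm
      (u.map (machine M N L ℬ b₀ bs ans).inputAlphabet.symm)
      (some (l.map (machine M N L ℬ b₀ bs ans).outputAlphabet.symm)) t) := by
  obtain ⟨m, hm, hs⟩ := H
  refine ⟨⟨⟨m, StepsTo.iff_iterate.1 ?_⟩, hm⟩⟩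
  have h0 : (initList (machine M N L ℬ b₀ bs ans).tm
      (u.map (machine M N L ℬ b₀ bs ans).inputAlphabet.symm)).stk =
      stk (single M.tm.k₀ (u.map M.inputAlphabet.symm)) Work.empty := by
    funext k
    rcases k with k | k
    · by_cases hk : k = M.tm.k₀
      · subst hk
        simp [initList, machine, single]
        rfl
      · simp [initList, machine, single, hk]
    · cases k <;> rfl
  have h1 : (haltList (machine M N L ℬ b₀ bs ans).tm
      (l.map (machine M N L ℬ b₀ bs ans).outputAlphabet.symm)).stk =
      stk (single M.tm.k₁ (l.map M.outputAlphabet.symm)) Work.empty := by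
    funext k
    rcases k with k | k
    · by_cases hk : k = M.tm.k₁
      · subst hk
        simp [haltList, machine, single]
        rfl
      · simp [haltList, machine, single, hk]
    · cases k <;> rfl
  rw [← h0, ← h1] at hs
  exact hs

theorem machine_of_short [Finite B] {ans : List (CSPInput.Sym σ) → List B} (hu : u.length < L) :
    Nonempty (TM2OutputsInTime (machine M N L ℬ b₀ bs ans).tm
      (u.map (machine M N L ℬ b₀ bs ans).inputAlphabet.symm)
      (some ((ans u).map (machine M N L ℬ b₀ bs ans).outputAlphabet.symm))
      (4 * u.length + 4)) := by
  obtain ⟨buf, h1, h2⟩ := runs_readInput (M := M) (N := N) (L := L) (q := M.tm.initialState)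
    (sym := none) (vals := .nil) (buf := .nil) (w := []) (wR := []) (h := []) (hR := []) (p := [])
    (pR := []) (d := []) (dR := []) (e := []) (u.map M.inputAlphabet.symm) (Nat.zero_le _)
  have hbuf : buf.1 = u := by
    rw [h1]
    simpa [BoundedList.nil, Function.comp_def] using hu.le
  refine machine_outputsInTime ((h2.seq (.cases_goto (i := some buf)
    (v₁ := reg M.tm.initialState none .nil buf)
    (S₁ := stk (fun _ => []) ⟨[], u.reverse, [], [], [], [], [], [], []⟩) ?_
    (runs_short (ans := ans)))).congr ?_ ?_)
  · simp [stepAux, reg, hbuf, hu, Function.comp_def]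
  · rw [hbuf]
  · simp
    omega

theorem machine_of_long [Finite B] {ans : List (CSPInput.Sym σ) → List B} (hL : L ≤ u.length)
    {n τ : ℕ} {cs : List (Σ i : Fin σ.m, (Fin (σ.arity i) → Fin n))}
    (hN : ∀ i, σ.arity i ≤ N) (hbs : bs ≠ []) (hn : bs.length ≤ n) (hh : h.length = n)
    (hu : u = List.replicate n .tick ++ cs.flatMap CSPInput.encodeConstraint)
    (hM : TM2OutputsInTime M.tm (u.map M.inputAlphabet.symm)
      (some (h.map M.outputAlphabet.symm)) τ) :
    ∃ x < n - (bs.length - 1),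
      (∀ j < n - (bs.length - 1), valueOf ℬ b₀ cs h (List.replicate j none ++ bs.map some) ≤
        valueOf ℬ b₀ cs h (List.replicate x none ++ bs.map some)) ∧
      Nonempty (TM2OutputsInTime (machine M N L ℬ b₀ bs ans).tm
        (u.map (machine M N L ℬ b₀ bs ans).inputAlphabet.symm)
        (some (((List.range n).map (valueAt b₀ h (List.replicate x none ++ bs.map some))).map
          (machine M N L ℬ b₀ bs ans).outputAlphabet.symm))
        (τ + u.length * (12 * u.length + 6) + 20 * u.length + 22)) := by
  obtain ⟨buf, h1, h2⟩ := runs_readInput (M := M) (N := N) (L := L) (q := M.tm.initialState)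
    (sym := none) (vals := .nil) (buf := .nil) (w := []) (wR := []) (h := []) (hR := []) (p := [])
    (pR := []) (d := []) (dR := []) (e := []) (u.map M.inputAlphabet.symm) (Nat.zero_le _)
  have hbuf : buf.1.length = L := by
    rw [h1]
    simpa [BoundedList.nil, Function.comp_def] using hL
  obtain ⟨x, hx, hbest, hrun⟩ := runs_long (ℬ := ℬ) (b₀ := b₀) (buf := buf) hN hbs hn hh hu hM
  refine ⟨x, hx, hbest, machine_outputsInTime ((h2.seq (.cases_goto (i := none)
    (v₁ := reg M.tm.initialState none .nil buf)
    (S₁ := stk (fun _ => []) ⟨[], u.reverse, [], [], [], [], [], [], []⟩) ?_ hrun)).congr rfl ?_)⟩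
  · simp [stepAux, reg, hbuf, Function.comp_def]
  · simp
    omega

end Program

end SurAlg

/-! ### Encoding, size and value -/

namespace CSPInput

variable {σ : RelSignature}

/-- The code of a constraint can be read off from any word that begins with it. -/
theorem encodeConstraint_injective_append {n : ℕ} {c c' : Σ i : Fin σ.m, (Fin (σ.arity i) → Fin n)}
    {l l' : List (Sym σ)} (h : encodeConstraint c ++ l = encodeConstraint c' ++ l') :
    c = c' ∧ l = l' := by
  have entry : ∀ {a a' : ℕ} {l l' : List (Sym σ)},
      List.replicate a Sym.tick ++ Sym.endVar :: l =
        List.replicate a' Sym.tick ++ Sym.endVar :: l' →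
      a = a' ∧ l = l' := by
    intro a
    induction a with
    | zero => rintro (_ | a') l l' h <;> simp_all [List.replicate_succ]
    | succ a ih =>
      rintro (_ | a') l l' h
      · simp [List.replicate_succ] at h
      · simpa using ih (l := l) (l' := l') (a' := a') (by simpa [List.replicate_succ] using h)
  have entries : ∀ {a a' : List (Fin n)} {l l' : List (Sym σ)}, a.length = a'.length →
      (a.flatMap fun v : Fin n => List.replicate v.val Sym.tick ++ [Sym.endVar]) ++ l =
        (a'.flatMap fun v : Fin n => List.replicate v.val Sym.tick ++ [Sym.endVar]) ++ l' →
      a = a' ∧ l = l' := by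
    intro a
    induction a with
    | nil =>
      rintro (_ | _) l l' h h'
      · simpa using h'
      · simp at h
    | cons x a ih =>
      rintro (_ | ⟨y, a'⟩) l l' h h'
      · simp at h
      · obtain ⟨h1, h2⟩ := entry (by simpa using h')
        obtain ⟨rfl, rfl⟩ := ih (by simpa using h) h2
        exact ⟨by rw [Fin.ext h1], rfl⟩
  obtain ⟨i, t⟩ := c
  obtain ⟨i', t'⟩ := c'
  simp only [encodeConstraint, List.cons_append, List.cons.injEq, Sym.relSym.injEq] at h
  obtain ⟨rfl, h⟩ := h
  obtain ⟨h1, h2⟩ := entries (by simp) h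
  exact ⟨by rw [List.ofFn_injective h1], h2⟩

theorem encode_injective : Function.Injective (encode (σ := σ)) := by
  have ticks : ∀ {n n' : ℕ} {cs : List (Σ i : Fin σ.m, (Fin (σ.arity i) → Fin n))}
      {cs' : List (Σ i : Fin σ.m, (Fin (σ.arity i) → Fin n'))},
      List.replicate n Sym.tick ++ cs.flatMap encodeConstraint =
        List.replicate n' Sym.tick ++ cs'.flatMap encodeConstraint → n = n' := by
    intro n n' cs cs' h
    have key : ∀ {n n' : ℕ} (cs : List (Σ i : Fin σ.m, (Fin (σ.arity i) → Fin n'))),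
        (List.replicate n Sym.tick ++ cs.flatMap encodeConstraint).takeWhile
          (fun s : Sym σ => match s with | .tick => true | _ => false) =
          List.replicate n Sym.tick := by
      intro n n' cs
      rw [List.takeWhile_append_of_pos (by simp)]
      cases cs <;> simp [encodeConstraint]
    have := congrArg (List.takeWhile (fun s : Sym σ => match s with | .tick => true | _ => false)) h
    rw [key, key] at this
    simpa using congrArg List.length this
  rintro ⟨n, cs, hcs⟩ ⟨n', cs', hcs'⟩ h
  simp only [encode] at h
  obtain rfl := ticks h
  replace h := List.append_cancel_left h
  have : cs = cs' := by
    clear hcs hcs'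
    induction cs generalizing cs' with
    | nil => cases cs' <;> simp_all [encodeConstraint]
    | cons c cs ih =>
      rcases cs' with _ | ⟨c', cs'⟩
      · simp [encodeConstraint] at h
      · obtain ⟨rfl, h'⟩ := encodeConstraint_injective_append (by simpa using h)
        rw [ih _ h']
  subst this
  rfl

/-- The cardinality of a set of constraints, summed up by relation symbols. -/
theorem sum_ncard_fiber {m : ℕ} {X : Fin m → Type} (S : Finset (Σ i, X i)) :
    ∑ i, {t | (⟨i, t⟩ : Σ i, X i) ∈ S}.ncard = S.card := by
  classical
  rw [Finset.card_eq_sum_card_fiberwise (f := Sigma.fst) (t := Finset.univ) (by simp)]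
  refine Finset.sum_congr rfl fun i _ => ?_
  rw [← Set.ncard_image_of_injective _ (sigma_mk_injective (i := i)), ← Set.ncard_coe_finset]
  congr 1
  ext ⟨j, t⟩
  constructor
  · rintro ⟨t, ht, h⟩
    cases h
    simpa using ht
  · intro h
    simp only [Finset.coe_filter, Set.mem_ofPred_eq] at h
    obtain ⟨h, rfl⟩ := h
    exact ⟨t, h, rfl⟩

theorem size_toStructure (I : CSPInput σ) : I.toStructure.size = I.n + I.constraints.length := by
  classical
  have := sum_ncard_fiber I.constraints.toFinset
  rw [List.toFinset_card_of_nodup I.nodup] at this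
  simpa [RelStructure.size, toStructure] using this

open Classical in
theorem preserved_toStructure {B : Type} (I : CSPInput σ) (ℬ : RelStructure σ B)
    (g : Fin I.n → B) :
    I.toStructure.preserved ℬ g =
      (I.constraints.map fun c => if g ∘ c.2 ∈ ℬ.rel c.1 then 1 else 0).sum := by
  have h := sum_ncard_fiber (I.constraints.toFinset.filter fun c => g ∘ c.2 ∈ ℬ.rel c.1)
  have h1 : (I.constraints.toFinset.filter fun c => g ∘ c.2 ∈ ℬ.rel c.1).card =
      (I.constraints.filter fun c => g ∘ c.2 ∈ ℬ.rel c.1).length := by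
    rw [← List.toFinset_card_of_nodup (I.nodup.filter _), List.toFinset_filter]
    simp
  have h2 : ∀ cs : List (Σ i : Fin σ.m, (Fin (σ.arity i) → Fin I.n)),
      (cs.map fun c => if g ∘ c.2 ∈ ℬ.rel c.1 then 1 else 0).sum =
        (cs.filter fun c => g ∘ c.2 ∈ ℬ.rel c.1).length := by
    intro cs
    induction cs with
    | nil => rfl
    | cons c cs ih =>
      by_cases hc : g ∘ c.2 ∈ ℬ.rel c.1
      · simp [hc, ih, add_comm]
      · simp [hc, ih]
  rw [h2, ← h1, ← h]
  simp [RelStructure.preserved, toStructure]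

theorem length_encode_le (I : CSPInput σ) {N : ℕ} (hN : ∀ i, σ.arity i ≤ N) :
    I.encode.length ≤ I.n + I.constraints.length * (1 + N * I.n) := by
  have hc : ∀ c : Σ i : Fin σ.m, (Fin (σ.arity i) → Fin I.n),
      (encodeConstraint c).length ≤ 1 + N * I.n := by
    intro c
    have : ∀ l : List (Fin I.n),
        (l.flatMap fun v : Fin I.n =>
          List.replicate v.val Sym.tick ++ [(Sym.endVar : Sym σ)]).length ≤
          l.length * I.n := by
      intro l
      induction l with
      | nil => simp
      | cons x l ih =>
        simp only [List.flatMap_cons, List.length_append, List.length_replicate, List.length_cons,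
          List.length_nil]
        have := x.2
        rw [Nat.add_mul]
        omega
    have h1 := this (List.ofFn c.2)
    rw [List.length_ofFn] at h1
    have h2 := Nat.mul_le_mul_right I.n (hN c.1)
    simp only [encodeConstraint, List.length_cons]
    omega
  have : ∀ cs : List (Σ i : Fin σ.m, (Fin (σ.arity i) → Fin I.n)),
      (cs.flatMap encodeConstraint).length ≤ cs.length * (1 + N * I.n) := by
    intro cs
    induction cs with
    | nil => simp
    | cons c cs ih =>
      rw [List.flatMap_cons, List.length_append, List.length_cons, Nat.add_mul]
      have := hc c
      omega
  have := this I.constraints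
  simp only [encode, List.length_append, List.length_replicate]
  omega

/-- The encodings of the structures with fewer than `n₀` elements are of bounded length, as the
constraints are listed without repetition. -/
theorem exists_length_encode_lt (σ : RelSignature) (n₀ : ℕ) :
    ∃ L, ∀ I : CSPInput σ, I.n < n₀ → I.encode.length < L := by
  have hN : ∀ i, σ.arity i ≤ ∑ i, σ.arity i := fun i =>
    Finset.single_le_sum (fun _ _ => Nat.zero_le _) (Finset.mem_univ i)
  refine ⟨(Finset.range n₀).sup (fun n => n +
    Fintype.card (Σ i : Fin σ.m, (Fin (σ.arity i) → Fin n)) * (1 + (∑ i, σ.arity i) * n)) + 1,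
    fun I hI => Nat.lt_succ_of_le ((I.length_encode_le hN).trans ?_)⟩
  refine le_trans ?_ (Finset.le_sup (Finset.mem_range.2 hI))
  gcongr
  exact I.nodup.length_le_card

end CSPInput

/-! ### Loss caused by the windows -/

namespace SurAlg

variable {σ : RelSignature} {B : Type} {ℬ : RelStructure σ B} {N : ℕ} {b₀ : B} {bs h : List B}

open Classical in
theorem score_ofFn {i : Fin σ.m} {t : Fin (σ.arity i) → B} :
    score ℬ (some i) (List.ofFn t) = if t ∈ ℬ.rel i then 1 else 0 := by
  unfold score
  congr 1
  simp only [Sat, Option.some.injEq, eq_iff_iff]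
  constructor
  · rintro ⟨j, rfl, u, hu, hut⟩
    rwa [← List.ofFn_injective hut]
  · exact fun ht => ⟨i, rfl, t, ht, rfl⟩

theorem preserved_eq_valueOf (I : CSPInput σ) (p : List (Option B)) :
    I.toStructure.preserved ℬ (fun v => valueAt b₀ h p v) =
      valueOf ℬ b₀ I.constraints h p := by
  rw [CSPInput.preserved_toStructure, valueOf]
  simp only [score_ofFn]
  rfl

theorem valueAt_window_of_not_mem {j t : ℕ} (ht : t < j ∨ j + bs.length ≤ t) :
    valueAt b₀ h (List.replicate j none ++ bs.map some) t = valueAt b₀ h [] t := by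
  rcases ht with ht | ht
  · simp [valueAt, List.getElem?_append, ht]
  · rw [valueAt, List.getElem?_eq_none (by simpa using ht)]
    simp [valueAt]

theorem valueAt_window {j t : ℕ} (ht : t < bs.length) :
    valueAt b₀ h (List.replicate j none ++ bs.map some) (j + t) = bs[t] := by
  simp [valueAt, ht]

/-- The windows that contain an entry of a tuple are few. -/
theorem card_filter_window_le {k n J b : ℕ} (t : Fin k → Fin n) :
    ((Finset.range J).filter fun j => ∃ a, j ≤ (t a : ℕ) ∧ (t a : ℕ) < j + b).card ≤ k * b := by
  have hsub : ((Finset.range J).filter fun j => ∃ a, j ≤ (t a : ℕ) ∧ (t a : ℕ) < j + b) ⊆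
      Finset.univ.biUnion fun a => Finset.Icc ((t a : ℕ) + 1 - b) (t a) := by
    intro j hj
    simp only [Finset.mem_filter] at hj
    obtain ⟨-, a, h1, h2⟩ := hj
    simp only [Finset.mem_biUnion, Finset.mem_univ, true_and, Finset.mem_Icc]
    exact ⟨a, by omega, h1⟩
  refine (Finset.card_le_card hsub).trans (Finset.card_biUnion_le.trans ?_)
  refine (Finset.sum_le_card_nsmul _ _ b fun a _ => ?_).trans (by simp)
  rw [Nat.card_Icc]
  omega

/-- All windows together lose at most `N * |bs|` times the value of the assignment: a satisfied
constraint is lost only by windows that contain one of its at most `N` entries. -/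
theorem sum_valueOf_window {n : ℕ} (cs : List (Σ i : Fin σ.m, (Fin (σ.arity i) → Fin n)))
    (hN : ∀ i, σ.arity i ≤ N) (J : ℕ) :
    J * valueOf ℬ b₀ cs h [] ≤
      ∑ j ∈ Finset.range J, valueOf ℬ b₀ cs h (List.replicate j none ++ bs.map some) +
        N * bs.length * valueOf ℬ b₀ cs h [] := by
  classical
  induction cs with
  | nil => simp [valueOf]
  | cons c cs ih =>
    simp only [valueOf, List.map_cons, List.sum_cons, Finset.sum_add_distrib, Nat.mul_add] at ih ⊢
    simp only [score_ofFn] at ih ⊢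
    have key : J * (if (fun a => valueAt b₀ h [] (c.2 a)) ∈ ℬ.rel c.1 then 1 else 0) ≤
        ∑ j ∈ Finset.range J, (if (fun a => valueAt b₀ h (List.replicate j none ++ bs.map some)
          (c.2 a)) ∈ ℬ.rel c.1 then 1 else 0) + N * bs.length *
          (if (fun a => valueAt b₀ h [] (c.2 a)) ∈ ℬ.rel c.1 then 1 else 0) := by
      split
      · rename_i hsat
        rw [← Finset.card_filter, mul_one, mul_one]
        have h1 := (card_filter_window_le (J := J) (b := bs.length) c.2).trans
          (Nat.mul_le_mul_right _ (hN c.1))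
        have h2 := Finset.card_filter_add_card_filter_not (s := Finset.range J)
          (fun j => ∃ a, j ≤ (c.2 a : ℕ) ∧ (c.2 a : ℕ) < j + bs.length)
        rw [Finset.card_range] at h2
        have h3 : ((Finset.range J).filter fun j =>
            ¬ ∃ a, j ≤ (c.2 a : ℕ) ∧ (c.2 a : ℕ) < j + bs.length).card ≤
            ((Finset.range J).filter fun j =>
            (fun a => valueAt b₀ h (List.replicate j none ++ bs.map some) (c.2 a)) ∈
              ℬ.rel c.1).card := by
          refine Finset.card_le_card fun j hj => ?_
          simp only [Finset.mem_filter, not_exists, not_and, not_lt] at hj ⊢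
          refine ⟨hj.1, ?_⟩
          convert hsat using 2 with a
          refine valueAt_window_of_not_mem ?_
          have := hj.2 a
          omega
        omega
      · simp
    omega

end SurAlg

/-! ### Optimal solutions and approximation -/

theorem exists_surjective_fin {B : Type} [Finite B] [Nonempty B] {n : ℕ} (h : Nat.card B ≤ n) :
    ∃ f : Fin n → B, Function.Surjective f := by
  have := Fintype.ofFinite B
  rw [Nat.card_eq_fintype_card] at h
  obtain ⟨e⟩ := Function.Embedding.nonempty_of_card_le (α := B) (β := Fin n) (by simpa using h)
  exact ⟨_, Function.invFun_surjective e.injective⟩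

namespace SurAlg

variable {σ : RelSignature} {B : Type}

/-- Overriding a window by a list of all elements makes an assignment surjective. -/
theorem surjective_valueAt_window {b₀ : B} {bs h : List B} (hbs : ∀ b, b ∈ bs) {n x : ℕ}
    (hx : x + bs.length ≤ n) : Function.Surjective fun v : Fin n =>
      valueAt b₀ h (List.replicate x none ++ bs.map some) v := by
  intro b
  obtain ⟨t, ht, rfl⟩ := List.mem_iff_getElem.1 (hbs b)
  exact ⟨⟨x + t, by omega⟩, valueAt_window ht⟩

/-- A table of optimal solutions exists; it is well defined as the encoding is injective. -/
theorem exists_table [Finite B] [Nonempty B] (ℬ : RelStructure σ B) :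
    ∃ ans : List (CSPInput.Sym σ) → List B, ∀ I : CSPInput σ, Nat.card B ≤ I.n →
      ∃ g : Fin I.n → B, Function.Surjective g ∧ ans I.encode = List.ofFn g ∧
        ∀ g', Function.Surjective g' →
          I.toStructure.preserved ℬ g' ≤ I.toStructure.preserved ℬ g := by
  have hopt : ∀ I : {I : CSPInput σ // Nat.card B ≤ I.n}, ∃ g : Fin I.1.n → B,
      Function.Surjective g ∧ ∀ g', Function.Surjective g' →
        I.1.toStructure.preserved ℬ g' ≤ I.1.toStructure.preserved ℬ g := by
    intro I
    obtain ⟨f, hf⟩ := exists_surjective_fin I.2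
    have : Nonempty {g : Fin I.1.n → B // Function.Surjective g} := ⟨⟨f, hf⟩⟩
    obtain ⟨g, hg⟩ := Finite.exists_max
      fun g : {g : Fin I.1.n → B // Function.Surjective g} => I.1.toStructure.preserved ℬ g.1
    exact ⟨g.1, g.2, fun g' hg' => hg ⟨g', hg'⟩⟩
  choose opt hsurj hmax using hopt
  refine ⟨Function.extend (fun I : {I : CSPInput σ // Nat.card B ≤ I.n} => I.1.encode)
    (fun I => List.ofFn (opt I)) fun _ => [], fun I hI => ⟨opt ⟨I, hI⟩, hsurj _, ?_, hmax ⟨I, hI⟩⟩⟩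
  have hinj : Function.Injective
      fun I : {I : CSPInput σ // Nat.card B ≤ I.n} => I.1.encode :=
    CSPInput.encode_injective.comp Subtype.val_injective
  exact hinj.extend_apply (fun I => List.ofFn (opt I)) _ ⟨I, hI⟩

/-- If `J` modifications of a solution of value `vs` lose at most `C * vs` altogether, then the best
of them, of value `vg`, is an `(r - ε)`-approximation. -/
theorem approx_of_average {r ε : ℝ} (hr₀ : 0 < r) (hr₁ : r ≤ 1) (hε : 0 < ε) {J C vs vg vo vc : ℕ}
    (hJ : 0 < J) (hC : C ≤ ε * J) (hsum : J * vs ≤ J * vg + C * vs) (hle : vo ≤ vc)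
    (hs : r * vc ≤ vs) : (r - ε) * vo ≤ vg := by
  have hJ' : (0 : ℝ) < J := by exact_mod_cast hJ
  have hmain : (J : ℝ) * vs ≤ J * vg + C * vs := by exact_mod_cast hsum
  have hvs : (0 : ℝ) ≤ vs := Nat.cast_nonneg _
  have hvo : (0 : ℝ) ≤ vo := Nat.cast_nonneg _
  have hvg : (0 : ℝ) ≤ vg := Nat.cast_nonneg _
  have h1 : (vs : ℝ) ≤ vg + ε * vs := by
    refine le_of_mul_le_mul_left ?_ hJ'
    nlinarith [mul_le_mul_of_nonneg_right hC hvs]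
  have hle' : (vo : ℝ) ≤ vc := by exact_mod_cast hle
  rcases le_total r ε with hrε | hrε
  · nlinarith
  · have h2 : r * vo ≤ vs := (mul_le_mul_of_nonneg_left hle' hr₀.le).trans hs
    have h3 : (1 - ε) * (r * vo) ≤ (1 - ε) * vs := mul_le_mul_of_nonneg_left h2 (by linarith)
    nlinarith [mul_nonneg (mul_nonneg hε.le (by linarith : 0 ≤ 1 - r)) hvo]

end SurAlg

theorem mainTheorem2 {σ : RelSignature} {B : Type} [Finite B] (ℬ : RelStructure σ B)
    (r : ℝ) (hr₀ : 0 < r) (hr₁ : r ≤ 1) (h : (maxCSP ℬ).PolyTimeApproximable r) :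
    ∀ ε : ℝ, 0 < ε → (maxSurCSP ℬ).PolyTimeApproximable (r - ε) := by
  intro ε hε
  obtain ⟨(M : TM2ComputableAux (CSPInput.Sym σ) B), p, hM⟩ := h
  -- If `B` were empty, the structure with one element and no constraint would have no solution.
  obtain ⟨b₀⟩ : Nonempty B := by
    obtain ⟨s, -⟩ := hM ⟨1, [], List.nodup_nil⟩
    exact ⟨s (0 : Fin 1)⟩
  have := Fintype.ofFinite B
  have : Nonempty B := ⟨b₀⟩
  set N := ∑ i, σ.arity i
  have hN : ∀ i, σ.arity i ≤ N := fun i =>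
    Finset.single_le_sum (fun _ _ => Nat.zero_le _) (Finset.mem_univ i)
  set bs := (Finset.univ : Finset B).toList with hbsdef
  have hmem : ∀ b, b ∈ bs := by simp [hbsdef]
  have hbs : bs ≠ [] := List.ne_nil_of_mem (hmem b₀)
  have hpos := List.length_pos_of_ne_nil hbs
  -- From `n₀` elements on there are enough windows to make the average loss small.
  set n₀ := bs.length + ⌈(N * bs.length : ℕ) / ε⌉₊ with hn₀
  obtain ⟨L, hL⟩ := CSPInput.exists_length_encode_lt σ n₀
  obtain ⟨ans, hans⟩ := SurAlg.exists_table ℬ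
  -- `ℓ` bounds the length of the encoding in terms of the size.
  set ℓ : Polynomial ℕ := .X + .X * (1 + .C N * .X) with hℓ
  have hsize : ∀ I : CSPInput σ, I.encode.length ≤ ℓ.eval I.toStructure.size := by
    intro I
    refine (I.length_encode_le hN).trans ?_
    rw [I.size_toStructure]
    simp only [hℓ, Polynomial.eval_add, Polynomial.eval_mul, Polynomial.eval_X,
      Polynomial.eval_C, Polynomial.eval_one]
    gcongr <;> omega
  refine ⟨SurAlg.machine (B := B) M N L ℬ b₀ bs ans, p + ℓ * (12 * ℓ + 6) + 20 * ℓ + 22, ?_⟩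
  rintro ⟨I, hI⟩
  have htime : ∀ τ ≤ p.eval I.toStructure.size,
      τ + I.encode.length * (12 * I.encode.length + 6) + 20 * I.encode.length + 22 ≤
        (p + ℓ * (12 * ℓ + 6) + 20 * ℓ + 22).eval I.toStructure.size := by
    intro τ hτ
    have := hsize I
    simp only [Polynomial.eval_add, Polynomial.eval_mul, Polynomial.eval_ofNat]
    gcongr
  obtain ⟨go, hgo, hans, hmax⟩ := hans I hI
  have hgreatest : IsGreatest (Set.range ((maxSurCSP ℬ).val ⟨I, hI⟩))
      (I.toStructure.preserved ℬ go) :=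
    ⟨⟨⟨go, hgo⟩, rfl⟩, by rintro _ ⟨⟨g, hg⟩, rfl⟩; exact hmax g hg⟩
  rcases lt_or_ge I.encode.length L with hshort | hlong
  · obtain ⟨hrun⟩ := SurAlg.machine_of_short (M := M) (N := N) (ℬ := ℬ) (b₀ := b₀) (bs := bs)
      (ans := ans) hshort
    refine ⟨⟨go, hgo⟩, ⟨_, hgreatest, ?_⟩, ?_⟩
    · change (r - ε) * (I.toStructure.preserved ℬ go : ℝ) ≤ I.toStructure.preserved ℬ go
      have : (0 : ℝ) ≤ I.toStructure.preserved ℬ go := Nat.cast_nonneg _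
      nlinarith
    · rw [hans] at hrun
      refine ⟨hrun.toEvalsTo, hrun.steps_le_m.trans (le_trans ?_ (htime 0 (Nat.zero_le _)))⟩
      omega
  · have hn : n₀ ≤ I.n := not_lt.1 fun hlt => absurd (hL I hlt) (by omega)
    have hbn : bs.length ≤ I.n := by omega
    obtain ⟨(s : Fin I.n → B), ⟨vc, hvc, hs⟩, ⟨hrun⟩⟩ := hM I
    obtain ⟨x, hx, hbest, ⟨hrun'⟩⟩ := SurAlg.machine_of_long (M := M) (N := N) (L := L) (ℬ := ℬ)
      (b₀ := b₀) (bs := bs) (ans := ans) hlong hN hbs hbn (List.length_ofFn (f := s)) rfl hrun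
    set P := List.replicate x none ++ bs.map some
    set g : Fin I.n → B := fun v => SurAlg.valueAt b₀ (List.ofFn s) P v with hg
    have hsurj : Function.Surjective g := SurAlg.surjective_valueAt_window hmem (by omega)
    refine ⟨⟨g, hsurj⟩, ⟨_, hgreatest, ?_⟩, ?_⟩
    · have hvalg : I.toStructure.preserved ℬ g =
          SurAlg.valueOf ℬ b₀ I.constraints (List.ofFn s) P := SurAlg.preserved_eq_valueOf I P
      have hvals : I.toStructure.preserved ℬ s =
          SurAlg.valueOf ℬ b₀ I.constraints (List.ofFn s) [] := by
        rw [← SurAlg.preserved_eq_valueOf I []]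
        congr 1
        funext v
        simp [SurAlg.valueAt]
      set J := I.n - (bs.length - 1)
      have hsum := SurAlg.sum_valueOf_window (ℬ := ℬ) (b₀ := b₀) (bs := bs) (h := List.ofFn s)
        I.constraints hN J
      have hsum' := Finset.sum_le_card_nsmul (Finset.range J) _ _
        fun j hj => hbest j (Finset.mem_range.1 hj)
      rw [Finset.card_range, smul_eq_mul, ← hvalg] at hsum'
      rw [← hvals] at hsum
      have hC : (N * bs.length : ℕ) ≤ ε * J := by
        rw [← div_le_iff₀' hε]
        refine (Nat.le_ceil _).trans ?_
        exact_mod_cast (by omega)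
      exact SurAlg.approx_of_average hr₀ hr₁ hε (by omega) hC
        (hsum.trans (Nat.add_le_add_right hsum' _)) (hvc.2 ⟨go, rfl⟩) hs
    · have hout : (List.range I.n).map (SurAlg.valueAt b₀ (List.ofFn s) P) = List.ofFn g :=
        List.ext_getElem (by simp) fun i h1 h2 => by simp [hg]
      rw [hout] at hrun'
      exact ⟨hrun'.toEvalsTo, hrun'.steps_le_m.trans (htime _ le_rfl)⟩
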